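/- Theorem 3.1. Let $d\ge 1$, let $p_1,\dots,p_d\ge 1$ be pairwise coprime integers, $P=p_1\cdots p_d$, and $0<r<1$. Let $(\sigma_{\mathbf i})_{\mathbf i\in\mathbb N^d}$ ($\mathbb N=\{1,2,\dots\}$) be independent $\{+1,-1\}$-valued random variables under $\mathbb P_r$ with $\mathbb P_r(\sigma_{\mathbf i}=1)=r$. For $\mathbf N=(N_1,\dots,N_d)\in\mathbb N^d$ write $|\mathbf N|=N_1\cdots N_d$ and $$S^{\mathbf p}_{\mathbf N}=\sum_{i_1=1}^{N_1}\cdots\sum_{i_d=1}^{N_d}\sigma_{\mathbf i}\,\sigma_{\mathbf p\cdot\mathbf i},\qquad \mathbf p\cdot\mathbf i=(p_1i_1,\dots,p_di_d).$$ Limits $\mathbf N\to\infty$ mean $N_1,\dots,N_d\to\infty$ jointly. Then for every $\beta\in\mathbb R$ the free energy $$F_r(\beta)=\lim_{\mathbf N\to\infty}\frac1{|\mathbf N|}\log\mathbb E_r\left(e^{\beta S^{\mathbf p}_{\mathbf N}}\right)$$ exists in $\mathbb R$, and the following hold. (1) If $p_1,\dots,p_d$ are not all equal to $1$, then for every $\beta\in\mathbb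 R$ $$F_r(\beta)=\frac{2P-1}{2P}\log(r(1-r))+\frac{P-1}{P}\log|v^Te_+|^2+\log\Lambda_++\mathcal G(\beta),$$ where $h=\frac12\log\frac r{1-r}$, $v^T=(e^{h/2},e^{-h/2})$, $\Lambda_\pm=e^\beta\left(\cosh h\pm\sqrt{\sinh^2h+e^{-4\beta}}\right)$, $e_+=w_+/\|w_+\|$ with $w_+=(-e^{-\beta},\,e^{h+\beta}-\Lambda_+)^T$, and $\mathcal G(\beta)$ is the convergent series $$\mathcal G(\beta)=\sum_{\ell=1}^\infty\frac{(P-1)^2}{P^{\ell+1}}\log\left(1+\left(\frac{2\cosh h}{|v^Te_+|^2}-1\right)\left(\frac{\Lambda_-}{\Lambda_+}\right)^\ell\right).$$ (2) $F_r$ is differentiable on $\mathbb R$. (3) The averages $S^{\mathbf p}_{\mathbf N}/|\mathbf N|$ satisfy a large deviation principle as $\mathbf N\to\infty$ with speed $|\mathbf N|$ and rate function $$I_r(x)=\sup_{\beta\in\mathbb R}\left(\beta x-F_r(\beta)\right)\in[0,\infty].$$ That is, $I_r$ is lower semicontinuous and $$\limsup_{\mathbf N\to\infty}\frac1{|\mathbf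 N|}\log\mathbb P_r\left(\frac{S^{\mathbf p}_{\mathbf N}}{|\mathbf N|}\in C\right)\le-\inf_CI_r,\qquad \liminf_{\mathbf N\to\infty}\frac1{|\mathbf N|}\log\mathbb P_r\left(\frac{S^{\mathbf p}_{\mathbf N}}{|\mathbf N|}\in U\right)\ge-\inf_UI_r$$ for all closed $C\subseteq\mathbb R$ and open $U\subseteq\mathbb R$. Moreover, for every $x\in\mathbb R$, $$I_r(x)=\lim_{\varepsilon\to0^+}\lim_{\mathbf N\to\infty}-\frac1{|\mathbf N|}\log\mathbb P_r\left(\frac{S^{\mathbf p}_{\mathbf N}}{|\mathbf N|}\in[x-\varepsilon,x+\varepsilon]\right),$$ where the inner limit exists in $[0,\infty]$ for all sufficiently small $\varepsilon>0$. Furthermore, if $F_r'(\eta)=y$, then $I_r(y)=\eta y-F_r(\eta)$. -/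

import Mathlib

open MeasureTheory ProbabilityTheory Filter Topology

noncomputable section

namespace MultIsing

/-- Spin configurations `σ ∈ {+1, -1}^(ℕ^d)`, where `ℕ` is the set of positive integers and the
two-point alphabet `{+1, -1}` is the unit group of `ℤ`. -/
abbrev Config (d : ℕ) : Type := (Fin d → ℕ+) → ℤˣ

/-- The product measure `ℙ_r`: independent spins, each `+1` with probability `r` and `-1` with
probability `1 - r`. -/
def spinMeasure (d : ℕ) (r : unitInterval) : Measure (Config d) :=
  Measure.infinitePi fun _ : Fin d → ℕ+ => bernoulliMeasure (1 : ℤˣ) (-1) r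

/-- The multiple sum `∑_{1 ≤ i_j ≤ N_j} σ_i σ_{p·i}`, where `p · i` is the coordinatewise
product. -/
def multipleSum {d : ℕ} (p N : Fin d → ℕ+) (σ : Config d) : ℝ :=
  ∑ i ∈ Finset.Icc 1 N, ((σ i : ℤ) : ℝ) * ((σ (p * i) : ℤ) : ℝ)

/-- The number `N_1 N_2 ⋯ N_d` of sites of the box, as a real number; also used for
`P = p_1 p_2 ⋯ p_d`. -/
def vol {d : ℕ} (N : Fin d → ℕ+) : ℝ := ∏ j, ((N j : ℕ) : ℝ)

/-- The multiple average `S / (N_1 ⋯ N_d)`. -/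
def multipleAverage {d : ℕ} (p N : Fin d → ℕ+) (σ : Config d) : ℝ :=
  multipleSum p N σ / vol N

/-- The finite-volume free energy `(N_1 ⋯ N_d)⁻¹ log 𝔼_r(exp(β S))`. -/
def finiteFreeEnergy {d : ℕ} (p : Fin d → ℕ+) (r : unitInterval) (β : ℝ) (N : Fin d → ℕ+) : ℝ :=
  Real.log (∫ σ, Real.exp (β * multipleSum p N σ) ∂(spinMeasure d r)) / vol N

/-- The external field `h = (1/2) log (r / (1 - r))`. -/
def field (r : ℝ) : ℝ := 1 / 2 * Real.log (r / (1 - r))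

/-- `Λ_+ = e^β (cosh h + √(sinh² h + e^{-4β}))`. -/
def lamPlus (r β : ℝ) : ℝ :=
  Real.exp β * (Real.cosh (field r) + Real.sqrt (Real.sinh (field r) ^ 2 + Real.exp (-4 * β)))

/-- `Λ_- = e^β (cosh h - √(sinh² h + e^{-4β}))`. -/
def lamMinus (r β : ℝ) : ℝ :=
  Real.exp β * (Real.cosh (field r) - Real.sqrt (Real.sinh (field r) ^ 2 + Real.exp (-4 * β)))

/-- The vector `v = (e^{h/2}, e^{-h/2})`. -/
def vVec (r : ℝ) : EuclideanSpace ℝ (Fin 2) :=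
  !₂[Real.exp (field r / 2), Real.exp (-field r / 2)]

/-- The eigenvector `w_+ = (-e^{-β}, e^{h+β} - Λ_+)` of the transfer matrix
`[[e^{β+h}, e^{-β}], [e^{-β}, e^{β-h}]]` for the eigenvalue `Λ_+`. -/
def wPlus (r β : ℝ) : EuclideanSpace ℝ (Fin 2) :=
  !₂[-Real.exp (-β), Real.exp (field r + β) - lamPlus r β]

/-- The normalized eigenvector `e_+ = w_+ / ‖w_+‖`. -/
def ePlus (r β : ℝ) : EuclideanSpace ℝ (Fin 2) := ‖wPlus r β‖⁻¹ • wPlus r β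

/-- `|v^T · e_+|^2`. -/
def overlapSq (r β : ℝ) : ℝ := |inner ℝ (vVec r) (ePlus r β)| ^ 2

/-- The term of index `ℓ` (used for `ℓ ≥ 1`) of the series `𝒢(β)`:
`(P-1)² / P^{ℓ+1} · log (1 + (2 cosh h / |v^T · e_+|² - 1) (Λ_- / Λ_+)^ℓ)`. -/
def gTerm (P r β : ℝ) (l : ℕ) : ℝ :=
  (P - 1) ^ 2 / P ^ (l + 1) *
    Real.log (1 + (2 * Real.cosh (field r) / overlapSq r β - 1) *
      (lamMinus r β / lamPlus r β) ^ l)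

/-- The Fenchel-Legendre transform `x ↦ sup_β (β x - F β)`, with values in `[-∞, ∞]`. -/
def legendre (F : ℝ → ℝ) (x : ℝ) : EReal := ⨆ β : ℝ, ((β * x - F β : ℝ) : EReal)

/-- The large deviation principle for the measures `μ n` along the filter `l` with speed `a n` and
rate function `I`. -/
structure SatisfiesLDP {α X : Type*} [TopologicalSpace X] [MeasurableSpace X] (l : Filter α)
    (a : α → ℝ) (μ : α → Measure X) (I : X → EReal) : Prop where
  nonneg : ∀ x, 0 ≤ I x
  lowerSemicontinuous : LowerSemicontinuous I
  upper_bound : ∀ C : Set X, IsClosed C →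
    limsup (fun n => ENNReal.log (μ n C) / (a n : EReal)) l ≤ -⨅ x ∈ C, I x
  lower_bound : ∀ U : Set X, IsOpen U →
    -(⨅ x ∈ U, I x) ≤ liminf (fun n => ENNReal.log (μ n U) / (a n : EReal)) l

/-- `I x = lim_{ε → 0} lim_n -(1 / a n) log μ_n([x - ε, x + ε])` for all `x`, as an iterated limit:
the inner limit exists in `[-∞, ∞]` for all small enough `ε > 0`, and the outer limit exists and
equals `I x`. -/
def IsLocalRate {α : Type*} (l : Filter α) (a : α → ℝ) (μ : α → Measure ℝ) (I : ℝ → EReal) : Prop :=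
  ∀ x : ℝ, ∃ J : ℝ → EReal,
    (∀ᶠ ε in 𝓝[>] (0 : ℝ), Tendsto
      (fun n => -(ENNReal.log (μ n (Set.Icc (x - ε) (x + ε))) / (a n : EReal))) l (𝓝 (J ε))) ∧
    Tendsto J (𝓝[>] (0 : ℝ)) (𝓝 (I x))

end MultIsing

end

/-! Suppose `p ≠ 1`. Every site is uniquely `p ^ k * j` with `j` not a multiple of `p`, so the
products `σ i * σ (p * i)` are the bonds of disjoint chains `j, p j, p² j, …`. Along each chain the
sum is the energy of an open one-dimensional Ising chain, and different chains use disjoint spins.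
The moment generating function therefore factors into one-dimensional partition functions
(`integral_exp_multipleSum`).

Write each logarithm as a sum of the increments gained per bond. The `k`-th increment occurs once
for every chain with more than `k` bonds. The density of such chains tends to `P⁻ᵏ - P⁻ᵏ⁻¹` and is
bounded by `P⁻ᵏ`, so dominated convergence gives the free energy as a series
(`tendsto_finiteFreeEnergy`). The derivatives of the increments grow only linearly in `k`, so the
series is differentiable. The partition functions obey a two-term recursion with characteristic
roots `√(r(1-r)) Λ_±`; solving it and summing by parts gives the closed form (`chainPartition_eq`,
`chainFreeEnergy_eq`). For `p = 1` the sum is deterministic and the free energy is `β`.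

The large deviation statements follow from a Gärtner–Ellis argument for bounded variables with a
differentiable limit. The upper bound is Chernoff plus compactness
(`eventually_measureReal_le_of_isClosed`). The lower bound at a slope `F' η` comes from splitting
the exponential moment (`eventually_le_measureReal_ball`). Other points of finite rate are
approached along segments towards `F' 0`, using Darboux and convexity of the Legendre transform. -/

namespace MultIsing

/-! ### Exponential upper and lower bounds for bounded variables -/

section GartnerEllis

theorem integrable_exp_mul_of_ae_abs_le {μ : Measure ℝ} [IsFiniteMeasure μ] {M : ℝ}
    (hM : ∀ᵐ x ∂μ, |x| ≤ M) (t β : ℝ) :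
    Integrable (fun x => Real.exp (t * (β * x))) μ := by
  refine Integrable.of_bound (by fun_prop) (Real.exp (|t| * (|β| * M))) ?_
  filter_upwards [hM] with x hx
  rw [Real.norm_eq_abs, Real.abs_exp, Real.exp_le_exp]
  calc t * (β * x) ≤ |t * (β * x)| := le_abs_self _
    _ = |t| * (|β| * |x|) := by rw [abs_mul, abs_mul]
    _ ≤ |t| * (|β| * M) := by gcongr

variable {α : Type*} {l : Filter α} {a : α → ℝ} {μ : α → Measure ℝ} {F : ℝ → ℝ} {M : ℝ}

theorem eventually_mgf_le (ha : Tendsto a l atTop) [∀ n, IsProbabilityMeasure (μ n)]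
    (hM : ∀ n, ∀ᵐ x ∂μ n, |x| ≤ M)
    (hF : ∀ β, Tendsto (fun n => cgf (fun x => β * x) (μ n) (a n) / a n) l (𝓝 (F β)))
    (β : ℝ) {u : ℝ} (hu : F β < u) :
    ∀ᶠ n in l, mgf (fun x => β * x) (μ n) (a n) ≤ Real.exp (a n * u) := by
  filter_upwards [(hF β).eventually_lt_const hu, ha.eventually_gt_atTop 0] with n h1 h2
  rw [div_lt_iff₀ h2] at h1
  rw [← exp_cgf (integrable_exp_mul_of_ae_abs_le (hM n) _ _), Real.exp_le_exp]
  linarith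

theorem eventually_le_mgf (ha : Tendsto a l atTop) [∀ n, IsProbabilityMeasure (μ n)]
    (hM : ∀ n, ∀ᵐ x ∂μ n, |x| ≤ M)
    (hF : ∀ β, Tendsto (fun n => cgf (fun x => β * x) (μ n) (a n) / a n) l (𝓝 (F β)))
    (β : ℝ) {u : ℝ} (hu : u < F β) :
    ∀ᶠ n in l, Real.exp (a n * u) ≤ mgf (fun x => β * x) (μ n) (a n) := by
  filter_upwards [(hF β).eventually_const_lt hu, ha.eventually_gt_atTop 0] with n h1 h2
  rw [lt_div_iff₀ h2] at h1
  rw [← exp_cgf (integrable_exp_mul_of_ae_abs_le (hM n) _ _), Real.exp_le_exp]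
  linarith

theorem eventually_const_le_exp_mul (ha : Tendsto a l atTop) {ε : ℝ} (hε : 0 < ε) (K : ℝ) :
    ∀ᶠ n in l, K ≤ Real.exp (a n * ε) :=
  (Real.tendsto_exp_atTop.comp (ha.atTop_mul_const hε)).eventually_ge_atTop K

/-- The mass lives on the compact set `C ∩ [-M, M]`, where finitely many `β` suffice because `u < β
* x - F β` is an open condition on `x`. Chernoff bounds each of these half-lines. -/
theorem eventually_measureReal_le_of_isClosed (ha : Tendsto a l atTop)
    [∀ n, IsProbabilityMeasure (μ n)] (hM : ∀ n, ∀ᵐ x ∂μ n, |x| ≤ M)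
    (hF : ∀ β, Tendsto (fun n => cgf (fun x => β * x) (μ n) (a n) / a n) l (𝓝 (F β)))
    {C : Set ℝ} (hC : IsClosed C) {s u : ℝ} (hsu : s < u)
    (h : ∀ x ∈ C, ∃ β, u < β * x - F β) :
    ∀ᶠ n in l, (μ n).real C ≤ Real.exp (-(a n * s)) := by
  have hK : IsCompact (C ∩ Set.Icc (-M) M) := isCompact_Icc.inter_left hC
  obtain ⟨T, hT⟩ := hK.elim_finite_subcover (fun β : ℝ => {x | u < β * x - F β})
    (fun β => isOpen_lt continuous_const (by fun_prop)) (fun x hx => by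
      obtain ⟨β, hβ⟩ := h x hx.1
      exact Set.mem_iUnion.2 ⟨β, hβ⟩)
  -- One half of the gap pays for the error in the limit of the exponential moments, the other for
  -- the number of half-lines.
  set ε := (u - s) / 2 with hε
  have hε0 : 0 < ε := by linarith
  have hall : ∀ᶠ n in l, ∀ β ∈ T,
      mgf (fun x => β * x) (μ n) (a n) ≤ Real.exp (a n * (F β + ε)) :=
    (Finset.eventually_all T).2 fun β _ => eventually_mgf_le ha hM hF β (by linarith)
  filter_upwards [hall, ha.eventually_gt_atTop 0, eventually_const_le_exp_mul ha hε0 T.card]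
    with n h1 h2 h3
  have hsub : (μ n).real C ≤ (μ n).real (⋃ β ∈ T, {x | F β + u ≤ β * x}) := by
    rw [measureReal_def, measureReal_def]
    refine ENNReal.toReal_mono (measure_ne_top _ _) (measure_mono_ae ?_)
    filter_upwards [hM n] with x hx hxC
    have := hT ⟨hxC, abs_le.1 hx⟩
    simp only [Set.mem_iUnion, Set.mem_ofPred_eq] at this
    obtain ⟨β, hβ, hb⟩ := this
    refine Set.mem_iUnion₂.2 ⟨β, hβ, ?_⟩
    simp only [Set.mem_ofPred_eq]
    linarith
  calc (μ n).real C ≤ _ := hsub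
    _ ≤ ∑ β ∈ T, (μ n).real {x | F β + u ≤ β * x} := measureReal_biUnion_finset_le _ _
    _ ≤ ∑ β ∈ T, Real.exp (-(a n * (u - ε))) := by
        refine Finset.sum_le_sum fun β hβ => ?_
        refine (measure_ge_le_exp_mul_mgf (X := fun x => β * x) _ h2.le
          (integrable_exp_mul_of_ae_abs_le (hM n) _ _)).trans ?_
        refine (mul_le_mul_of_nonneg_left (h1 β hβ) (Real.exp_nonneg _)).trans_eq ?_
        rw [← Real.exp_add]
        ring_nf
    _ = T.card * Real.exp (-(a n * (u - ε))) := by simp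
    _ ≤ Real.exp (a n * ε) * Real.exp (-(a n * (u - ε))) := by gcongr
    _ = Real.exp (-(a n * s)) := by
        rw [← Real.exp_add, hε]
        ring_nf

/-- These strict gaps, which come from differentiability, make the tails outside a ball around `y`
exponentially negligible after weighting by `exp (a η x)`. -/
theorem exists_shift_of_hasDerivAt {y η δ : ℝ} (hδ : 0 < δ) (hd : HasDerivAt F y η) :
    (∃ κ > 0, F (η + κ) < F η + κ * (y + δ)) ∧ ∃ κ > 0, F (η - κ) < F η - κ * (y - δ) := by
  have h := hd.isLittleO.def (half_pos hδ)
  rw [Metric.eventually_nhds_iff] at h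
  obtain ⟨ρ, hρ, h⟩ := h
  have hκ : ∀ κ : ℝ, |κ| < ρ → |F (η + κ) - F η - κ * y| ≤ δ / 2 * |κ| := fun κ hκ => by
    simpa [mul_comm] using @h (η + κ) (by simpa [Real.dist_eq] using hκ)
  have habs : |ρ / 2| = ρ / 2 := abs_of_pos (half_pos hρ)
  have hpos : 0 < δ / 2 * (ρ / 2) := by positivity
  refine ⟨⟨ρ / 2, half_pos hρ, ?_⟩, ρ / 2, half_pos hρ, ?_⟩
  · have := (abs_le.1 (hκ (ρ / 2) (by rw [habs]; linarith))).2
    rw [habs] at this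
    linarith
  · have := (abs_le.1 (hκ (-(ρ / 2)) (by rw [abs_neg, habs]; linarith))).2
    rw [abs_neg, habs, ← sub_eq_add_neg] at this
    linarith

/-- Bound `exp (a η x)` off the ball by exponentials with the shifted parameters `η + κ₁` and `η -
κ₂`. Their integrals are exponentially smaller than the moment at `η`, so the ball carries that
moment; on it the integrand is at most `exp (a (η y + |η| δ'))`. No tilted measure is needed. -/
theorem eventually_le_measureReal_ball (ha : Tendsto a l atTop)
    [∀ n, IsProbabilityMeasure (μ n)] (hM : ∀ n, ∀ᵐ x ∂μ n, |x| ≤ M)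
    (hF : ∀ β, Tendsto (fun n => cgf (fun x => β * x) (μ n) (a n) / a n) l (𝓝 (F β)))
    {y η δ s : ℝ} (hδ : 0 < δ) (hd : HasDerivAt F y η) (hs : η * y - F η < s) :
    ∀ᶠ n in l, Real.exp (-(a n * s)) ≤ (μ n).real (Metric.ball y δ) := by
  -- On the smaller ball the variation of `η * x` uses at most half of the slack in `s`.
  obtain ⟨δ', hδ', hδδ, hηδ⟩ : ∃ δ' > 0, δ' ≤ δ ∧ |η| * δ' ≤ (s - (η * y - F η)) / 2 := by
    refine ⟨min δ ((s - (η * y - F η)) / 2 / (|η| + 1)), ?_, min_le_left _ _, ?_⟩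
    · have : 0 < |η| + 1 := by positivity
      exact lt_min hδ (div_pos (by linarith) this)
    · have h1 : 0 < |η| + 1 := by positivity
      calc _ ≤ (|η| + 1) * ((s - (η * y - F η)) / 2 / (|η| + 1)) := by
            gcongr
            · linarith
            · exact min_le_right _ _
        _ = _ := by field_simp
  obtain ⟨⟨κ₁, hκ₁, h₁⟩, κ₂, hκ₂, h₂⟩ := exists_shift_of_hasDerivAt hδ' hd
  -- Margin `4ε`: limit errors reduce each tail to `exp (a (F η - 3ε))`, two tails cost one more
  -- `ε`, and subtracting them from `exp (a (F η - ε))` still leaves `exp (a (F η - 2ε))`.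
  obtain ⟨ε, hε, he1, he2, he3⟩ : ∃ ε > 0, F (η + κ₁) + 4 * ε ≤ F η + κ₁ * (y + δ') ∧
      F (η - κ₂) + 4 * ε ≤ F η - κ₂ * (y - δ') ∧ 4 * ε ≤ s - (η * y - F η) := by
    refine ⟨min (min ((F η + κ₁ * (y + δ') - F (η + κ₁)) / 4)
      ((F η - κ₂ * (y - δ') - F (η - κ₂)) / 4)) ((s - (η * y - F η)) / 4), ?_, ?_, ?_, ?_⟩
    · refine lt_min (lt_min ?_ ?_) ?_ <;> linarith
    · have := (min_le_left (min ((F η + κ₁ * (y + δ') - F (η + κ₁)) / 4)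
        ((F η - κ₂ * (y - δ') - F (η - κ₂)) / 4)) ((s - (η * y - F η)) / 4)).trans (min_le_left _ _)
      linarith
    · have := (min_le_left (min ((F η + κ₁ * (y + δ') - F (η + κ₁)) / 4)
        ((F η - κ₂ * (y - δ') - F (η - κ₂)) / 4)) ((s - (η * y - F η)) / 4)).trans (min_le_right _ _)
      linarith
    · have := min_le_right (min ((F η + κ₁ * (y + δ') - F (η + κ₁)) / 4)
        ((F η - κ₂ * (y - δ') - F (η - κ₂)) / 4)) ((s - (η * y - F η)) / 4)
      linarith
  filter_upwards [ha.eventually_gt_atTop 0, eventually_const_le_exp_mul ha hε 2,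
    eventually_mgf_le ha hM hF (η + κ₁) (lt_add_of_pos_right _ hε),
    eventually_mgf_le ha hM hF (η - κ₂) (lt_add_of_pos_right _ hε),
    eventually_le_mgf ha hM hF η (sub_lt_self _ hε)] with n hn h2 hm1 hm2 hm
  have hball : (μ n).real (Metric.ball y δ') ≤ (μ n).real (Metric.ball y δ) :=
    measureReal_mono (Metric.ball_subset_ball hδδ)
  refine le_trans ?_ hball
  have hint := fun β => integrable_exp_mul_of_ae_abs_le (hM n) (a n) β
  have hpt : ∀ x, Real.exp (a n * (η * x)) ≤
      (Metric.ball y δ').indicator (fun _ => Real.exp (a n * (η * y + |η| * δ'))) x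
      + (Real.exp (-(a n * (κ₁ * (y + δ')))) * Real.exp (a n * ((η + κ₁) * x))
      + Real.exp (a n * (κ₂ * (y - δ'))) * Real.exp (a n * ((η - κ₂) * x))) := by
    intro x
    rw [← Real.exp_add, ← Real.exp_add]
    by_cases hx : x ∈ Metric.ball y δ'
    · rw [Set.indicator_of_mem hx]
      refine le_add_of_le_of_nonneg ?_ (by positivity)
      rw [Real.exp_le_exp]
      refine mul_le_mul_of_nonneg_left ?_ hn.le
      rw [Metric.mem_ball, Real.dist_eq] at hx
      have : η * (x - y) ≤ |η| * δ' :=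
        (le_abs_self _).trans (by rw [abs_mul]; gcongr)
      linarith
    · rw [Set.indicator_of_notMem hx, zero_add]
      rw [Metric.mem_ball, Real.dist_eq, not_lt] at hx
      rcases le_abs.1 hx with hx | hx
      · refine le_add_of_le_of_nonneg ?_ (Real.exp_nonneg _)
        rw [Real.exp_le_exp]
        have : 0 ≤ a n * (κ₁ * (x - y - δ')) :=
          mul_nonneg hn.le (mul_nonneg hκ₁.le (by linarith))
        linarith
      · refine le_add_of_nonneg_of_le (Real.exp_nonneg _) ?_
        rw [Real.exp_le_exp]
        have : 0 ≤ a n * (κ₂ * (y - x - δ')) :=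
          mul_nonneg hn.le (mul_nonneg hκ₂.le (by linarith))
        linarith
  have hint1 : Integrable ((Metric.ball y δ').indicator
      (fun _ => Real.exp (a n * (η * y + |η| * δ')))) (μ n) :=
    (integrable_const _).indicator measurableSet_ball
  have hint2 : Integrable (fun x =>
      Real.exp (-(a n * (κ₁ * (y + δ')))) * Real.exp (a n * ((η + κ₁) * x))
      + Real.exp (a n * (κ₂ * (y - δ'))) * Real.exp (a n * ((η - κ₂) * x))) (μ n) :=
    ((hint (η + κ₁)).const_mul _).add ((hint (η - κ₂)).const_mul _)
  have hI := integral_mono (hint η) (hint1.add hint2) hpt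
  rw [integral_add' hint1 hint2, integral_indicator_const _ measurableSet_ball,
    integral_add ((hint (η + κ₁)).const_mul _) ((hint (η - κ₂)).const_mul _),
    integral_const_mul, integral_const_mul, smul_eq_mul] at hI
  change mgf (fun x => η * x) (μ n) (a n) ≤ _ + (_ * mgf (fun x => (η + κ₁) * x) (μ n) (a n) +
    _ * mgf (fun x => (η - κ₂) * x) (μ n) (a n)) at hI
  have e1 : Real.exp (-(a n * (κ₁ * (y + δ')))) * mgf (fun x => (η + κ₁) * x) (μ n) (a n) ≤
      Real.exp (a n * (F η - 3 * ε)) := by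
    refine (mul_le_mul_of_nonneg_left hm1 (Real.exp_nonneg _)).trans ?_
    rw [← Real.exp_add, Real.exp_le_exp]
    have := mul_le_mul_of_nonneg_left he1 hn.le
    linarith
  have e2 : Real.exp (a n * (κ₂ * (y - δ'))) * mgf (fun x => (η - κ₂) * x) (μ n) (a n) ≤
      Real.exp (a n * (F η - 3 * ε)) := by
    refine (mul_le_mul_of_nonneg_left hm2 (Real.exp_nonneg _)).trans ?_
    rw [← Real.exp_add, Real.exp_le_exp]
    have := mul_le_mul_of_nonneg_left he2 hn.le
    linarith
  have e3 : 2 * Real.exp (a n * (F η - 3 * ε)) ≤ Real.exp (a n * (F η - 2 * ε)) := by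
    calc _ ≤ Real.exp (a n * ε) * Real.exp (a n * (F η - 3 * ε)) := by gcongr
      _ = _ := by rw [← Real.exp_add]; ring_nf
  have e4 : 2 * Real.exp (a n * (F η - 2 * ε)) ≤ Real.exp (a n * (F η - ε)) := by
    calc _ ≤ Real.exp (a n * ε) * Real.exp (a n * (F η - 2 * ε)) := by gcongr
      _ = _ := by rw [← Real.exp_add]; ring_nf
  have e5 : Real.exp (a n * (F η - 2 * ε)) ≤
      (μ n).real (Metric.ball y δ') * Real.exp (a n * (η * y + |η| * δ')) := by linarith
  rw [← div_le_iff₀ (Real.exp_pos _), ← Real.exp_sub] at e5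
  refine le_trans ?_ e5
  rw [Real.exp_le_exp]
  have : 0 ≤ a n * (s - (η * y - F η) - |η| * δ' - 2 * ε) :=
    mul_nonneg hn.le (by linarith)
  linarith

end GartnerEllis

end MultIsing

namespace MultIsing

/-! ### The Legendre transform and the range of the derivative -/

section Legendre

variable {F : ℝ → ℝ}

theorem le_legendre (F : ℝ → ℝ) (x β : ℝ) : ((β * x - F β : ℝ) : EReal) ≤ legendre F x :=
  le_iSup (fun β : ℝ => ((β * x - F β : ℝ) : EReal)) β

theorem legendre_le_coe {x c : ℝ} (h : ∀ β, β * x - F β ≤ c) : legendre F x ≤ (c : EReal) :=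
  iSup_le fun β => EReal.coe_le_coe_iff.2 (h β)

theorem exists_lt_of_lt_legendre {x s : ℝ} (h : (s : EReal) < legendre F x) :
    ∃ β, s < β * x - F β := by
  obtain ⟨β, hβ⟩ := lt_iSup_iff.1 h
  exact ⟨β, EReal.coe_lt_coe_iff.1 hβ⟩

theorem legendre_nonneg (h0 : F 0 = 0) (x : ℝ) : 0 ≤ legendre F x := by
  simpa [h0] using le_legendre F x 0

theorem lowerSemicontinuous_legendre (F : ℝ → ℝ) : LowerSemicontinuous (legendre F) :=
  lowerSemicontinuous_iSup fun _ =>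
    (continuous_coe_real_ereal.comp (by fun_prop)).lowerSemicontinuous

theorem exists_forall_le_of_legendre_lt_top {x : ℝ} (h0 : F 0 = 0) (h : legendre F x < ⊤) :
    ∃ c : ℝ, legendre F x = c ∧ ∀ β, β * x - F β ≤ c := by
  have hb : legendre F x ≠ ⊥ :=
    ((EReal.bot_lt_zero).trans_le (legendre_nonneg h0 x)).ne'
  refine ⟨(legendre F x).toReal, (EReal.coe_toReal h.ne hb).symm, fun β => ?_⟩
  rw [← EReal.coe_le_coe_iff, EReal.coe_toReal h.ne hb]
  exact le_legendre F x β

theorem legendre_segment_le {x y c c' t : ℝ} (ht0 : 0 ≤ t) (ht1 : t ≤ 1)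
    (hx : ∀ β, β * x - F β ≤ c) (hy : ∀ β, β * y - F β ≤ c') :
    legendre F ((1 - t) * x + t * y) ≤ (((1 - t) * c + t * c' : ℝ) : EReal) := by
  refine legendre_le_coe fun β => ?_
  have h1 := mul_le_mul_of_nonneg_left (hx β) (sub_nonneg.2 ht1)
  have h2 := mul_le_mul_of_nonneg_left (hy β) ht0
  linarith

theorem le_of_legendre_eq {η y : ℝ}
    (h : legendre F y = ((η * y - F η : ℝ) : EReal)) (β : ℝ) : β * y - F β ≤ η * y - F η := by
  rw [← EReal.coe_le_coe_iff, ← h]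
  exact le_legendre F y β

theorem exists_le_deriv (hF : Differentiable ℝ F) {x z c : ℝ} (hzx : z < x)
    (hx : ∀ β, β * x - F β ≤ c) : ∃ η, z ≤ deriv F η := by
  by_contra! hcon
  set b := (c + |F 0| + 1) / (x - z) with hb
  have hxz : 0 < x - z := sub_pos.2 hzx
  have hc : -F 0 ≤ c := by simpa using hx 0
  have hb0 : 0 < b := div_pos (by linarith [neg_abs_le (F 0), le_abs_self (F 0)]) hxz
  obtain ⟨ξ, -, hξ⟩ := exists_deriv_eq_slope F hb0 hF.continuous.continuousOn
    hF.differentiableOn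
  have h1 := hcon ξ
  rw [hξ, sub_zero, div_lt_iff₀ hb0] at h1
  have h2 := hx b
  have h3 : b * (x - z) = c + |F 0| + 1 := by rw [hb]; field_simp
  linarith [le_abs_self (F 0)]

theorem exists_deriv_le (hF : Differentiable ℝ F) {x z c : ℝ} (hzx : x < z)
    (hx : ∀ β, β * x - F β ≤ c) : ∃ η, deriv F η ≤ z := by
  obtain ⟨η, hη⟩ := exists_le_deriv (F := fun β => F (-β)) (hF.comp differentiable_neg)
    (neg_lt_neg hzx) (c := c) (fun β => by simpa using hx (-β))
  refine ⟨-η, ?_⟩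
  rw [deriv_comp_neg] at hη
  linarith

/-- Darboux's theorem makes the set of slopes an interval, so neither convexity of `F` nor
continuity of its derivative is required. -/
theorem exists_deriv_eq_of_mem_segment (hF : Differentiable ℝ F) {x c t : ℝ} (ht0 : 0 < t)
    (ht1 : t ≤ 1) (hx : ∀ β, β * x - F β ≤ c) :
    ∃ η, deriv F η = (1 - t) * x + t * deriv F 0 := by
  have hconn := Set.ordConnected_univ.image_deriv (f := F) fun x _ => hF x
  suffices (1 - t) * x + t * deriv F 0 ∈ deriv F '' Set.univ by
    obtain ⟨η, -, hη⟩ := this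
    exact ⟨η, hη⟩
  rcases lt_trichotomy x (deriv F 0) with h | h | h
  · have hlt : 0 < t * (deriv F 0 - x) := mul_pos ht0 (by linarith)
    have hle : 0 ≤ (1 - t) * (deriv F 0 - x) := mul_nonneg (by linarith) (by linarith)
    obtain ⟨η, hη⟩ := exists_deriv_le hF (z := (1 - t) * x + t * deriv F 0) (by linarith) hx
    exact hconn.out ⟨η, trivial, rfl⟩ ⟨0, trivial, rfl⟩ ⟨hη, by linarith⟩
  · exact ⟨0, trivial, by rw [h]; ring⟩
  · have hlt : 0 < t * (x - deriv F 0) := mul_pos ht0 (by linarith)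
    have hle : 0 ≤ (1 - t) * (x - deriv F 0) := mul_nonneg (by linarith) (by linarith)
    obtain ⟨η, hη⟩ := exists_le_deriv hF (z := (1 - t) * x + t * deriv F 0) (by linarith) hx
    exact hconn.out ⟨0, trivial, rfl⟩ ⟨η, trivial, rfl⟩ ⟨by linarith, hη⟩

end Legendre

/-! ### Passing to extended-real logarithms -/

section ExtendedReal

theorem log_measure_div_le {μ : Measure ℝ} [IsProbabilityMeasure μ] {a s : ℝ} (ha : 0 < a)
    {A : Set ℝ} (h : μ.real A ≤ Real.exp (-(a * s))) :
    ENNReal.log (μ A) / (a : EReal) ≤ ((-s : ℝ) : EReal) := by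
  rw [EReal.div_le_iff_le_mul (by exact_mod_cast ha) (EReal.coe_ne_top a), ← EReal.coe_mul,
    ← ofReal_measureReal (measure_ne_top μ A)]
  refine (ENNReal.log_le_log (ENNReal.ofReal_le_ofReal h)).trans_eq ?_
  rw [ENNReal.log_ofReal_of_pos (Real.exp_pos _), Real.log_exp]
  ring_nf

theorem le_log_measure_div {μ : Measure ℝ} [IsProbabilityMeasure μ] {a s : ℝ} (ha : 0 < a)
    {A : Set ℝ} (h : Real.exp (-(a * s)) ≤ μ.real A) :
    ((-s : ℝ) : EReal) ≤ ENNReal.log (μ A) / (a : EReal) := by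
  rw [EReal.le_div_iff_mul_le (by exact_mod_cast ha) (EReal.coe_ne_top a), ← EReal.coe_mul,
    ← ofReal_measureReal (measure_ne_top μ A)]
  refine le_trans (le_of_eq ?_) (ENNReal.log_le_log (ENNReal.ofReal_le_ofReal h))
  rw [ENNReal.log_ofReal_of_pos (Real.exp_pos _), Real.log_exp]
  ring_nf

end ExtendedReal

/-! ### The large deviation principle and the local rate -/

section LargeDeviations

variable {α : Type*} {l : Filter α} {a : α → ℝ} {μ : α → Measure ℝ} {F : ℝ → ℝ} {M : ℝ}

theorem limit_cgf_zero [l.NeBot] [∀ n, IsProbabilityMeasure (μ n)]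
    (hF : ∀ β, Tendsto (fun n => cgf (fun x => β * x) (μ n) (a n) / a n) l (𝓝 (F β))) :
    F 0 = 0 :=
  tendsto_nhds_unique (hF 0) (by simp [cgf, mgf])

/-- Convexity of `F` is replaced by probability: a `β` doing better than `η` would force the mass
near `y` to decay faster than the lower bound for balls allows. -/
theorem legendre_eq_of_hasDerivAt [l.NeBot] (ha : Tendsto a l atTop)
    [∀ n, IsProbabilityMeasure (μ n)] (hM : ∀ n, ∀ᵐ x ∂μ n, |x| ≤ M)
    (hF : ∀ β, Tendsto (fun n => cgf (fun x => β * x) (μ n) (a n) / a n) l (𝓝 (F β)))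
    {η y : ℝ} (hd : HasDerivAt F y η) : legendre F y = ((η * y - F η : ℝ) : EReal) := by
  refine le_antisymm (legendre_le_coe fun β => ?_) (le_legendre F y η)
  by_contra! hlt
  obtain ⟨s, hs, hs'⟩ := exists_between hlt
  obtain ⟨s', hss', hs'⟩ := exists_between hs'
  obtain ⟨u, hu, hu'⟩ := exists_between hs'
  have hnhds : {x | u < β * x - F β} ∈ 𝓝 y :=
    (isOpen_lt continuous_const (by fun_prop)).mem_nhds hu'
  obtain ⟨δ, hδ, hsub⟩ := Metric.nhds_basis_closedBall.mem_iff.1 hnhds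
  obtain ⟨n, h1, h2, h3⟩ := ((eventually_measureReal_le_of_isClosed ha hM hF
    Metric.isClosed_closedBall hu fun x hx => ⟨β, hsub hx⟩).and
    ((eventually_le_measureReal_ball ha hM hF hδ hd hs).and (ha.eventually_gt_atTop 0))).exists
  have h4 := (h2.trans (measureReal_mono Metric.ball_subset_closedBall)).trans h1
  rw [Real.exp_le_exp] at h4
  have := mul_lt_mul_of_pos_left hss' h3
  linarith

theorem satisfiesLDP_legendre [l.NeBot] (ha : Tendsto a l atTop)
    [∀ n, IsProbabilityMeasure (μ n)] (hM : ∀ n, ∀ᵐ x ∂μ n, |x| ≤ M)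
    (hF : ∀ β, Tendsto (fun n => cgf (fun x => β * x) (μ n) (a n) / a n) l (𝓝 (F β)))
    (hdiff : Differentiable ℝ F) : SatisfiesLDP l a μ (legendre F) where
  nonneg := legendre_nonneg (limit_cgf_zero hF)
  lowerSemicontinuous := lowerSemicontinuous_legendre F
  upper_bound C hC := by
    rw [EReal.le_neg]
    refine EReal.ge_of_forall_gt_iff_ge.1 fun s hs => ?_
    obtain ⟨u, hsu, hu⟩ := EReal.lt_iff_exists_real_btwn.1 hs
    have hsu' : s < u := EReal.coe_lt_coe_iff.1 hsu
    obtain ⟨u', hsu', hu'⟩ := exists_between hsu'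
    rw [EReal.le_neg]
    refine limsup_le_of_le (by isBoundedDefault) ?_
    filter_upwards [eventually_measureReal_le_of_isClosed ha hM hF hC hsu' (u := u')
      (fun x hx => exists_lt_of_lt_legendre
        (lt_of_lt_of_le (EReal.coe_lt_coe_iff.2 hu') (hu.le.trans (iInf₂_le x hx)))),
      ha.eventually_gt_atTop 0] with n h1 h2
    simpa using log_measure_div_le h2 h1
  lower_bound U hU := by
    have h0 := limit_cgf_zero hF
    rw [EReal.neg_le]
    have key : ∀ η, deriv F η ∈ U →
        -liminf (fun n => ENNReal.log (μ n U) / (a n : EReal)) l ≤ legendre F (deriv F η) := by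
      intro η hη
      rw [legendre_eq_of_hasDerivAt ha hM hF (hdiff η).hasDerivAt]
      refine EReal.le_of_forall_lt_iff_le.1 fun s hs => ?_
      rw [EReal.neg_le]
      obtain ⟨δ, hδ, hsub⟩ := Metric.isOpen_iff.1 hU _ hη
      refine le_liminf_of_le (by isBoundedDefault) ?_
      filter_upwards [eventually_le_measureReal_ball ha hM hF hδ (hdiff η).hasDerivAt
        (EReal.coe_lt_coe_iff.1 hs), ha.eventually_gt_atTop 0] with n h1 h2
      simpa using le_log_measure_div h2 (h1.trans (measureReal_mono hsub))
    refine le_iInf₂ fun x hx => ?_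
    rcases eq_or_ne (legendre F x) ⊤ with htop | htop
    · rw [htop]
      exact le_top
    obtain ⟨c, hc, hxc⟩ := exists_forall_le_of_legendre_lt_top h0 htop.lt_top
    rw [hc]
    -- The point `x` need not be a slope of `F`, but points just off it towards `deriv F 0` are. The
    -- rate vanishes at `deriv F 0`, so by convexity moving there does not raise it above `c`.
    have hcont : Tendsto (fun t : ℝ => (1 - t) * x + t * deriv F 0) (𝓝[>] 0) (𝓝 x) := by
      have : Continuous (fun t : ℝ => (1 - t) * x + t * deriv F 0) := by fun_prop
      simpa using (this.tendsto 0).mono_left nhdsWithin_le_nhds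
    obtain ⟨t, htU, ht0, ht1⟩ := ((hcont.eventually_mem (hU.mem_nhds hx)).and
      (Ioc_mem_nhdsGT (zero_lt_one' ℝ))).exists
    obtain ⟨η, hη⟩ := exists_deriv_eq_of_mem_segment hdiff ht0 ht1 hxc
    refine (key η (hη ▸ htU)).trans ?_
    rw [hη]
    have hy := fun β => le_of_legendre_eq
      (legendre_eq_of_hasDerivAt ha hM hF (hdiff 0).hasDerivAt) β
    refine (legendre_segment_le ht0.le ht1 hxc hy).trans (EReal.coe_le_coe_iff.2 ?_)
    have hc0 : 0 ≤ c := by simpa [h0] using hxc 0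
    rw [h0]
    nlinarith

/-- An endpoint of finite rate is joined to `z` by a segment inside the open interval, and convexity
controls the rate along it. -/
theorem iInf_Ioo_le_iInf_Icc {F : ℝ → ℝ} (h0 : F 0 = 0) {u v z : ℝ} (hz : z ∈ Set.Ioo u v)
    (hfin : legendre F z < ⊤) :
    ⨅ x ∈ Set.Ioo u v, legendre F x ≤ ⨅ x ∈ Set.Icc u v, legendre F x := by
  refine le_iInf₂ fun y hy => ?_
  rcases eq_or_ne (legendre F y) ⊤ with htop | htop
  · rw [htop]
    exact le_top
  obtain ⟨c, hc, hyc⟩ := exists_forall_le_of_legendre_lt_top h0 htop.lt_top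
  obtain ⟨c', -, hzc⟩ := exists_forall_le_of_legendre_lt_top h0 hfin
  have hcont : Continuous fun t : ℝ => (((1 - t) * c + t * c' : ℝ) : EReal) :=
    continuous_coe_real_ereal.comp (by fun_prop)
  have hlim : Tendsto (fun t : ℝ => (((1 - t) * c + t * c' : ℝ) : EReal)) (𝓝[>] 0) (𝓝 c) := by
    simpa using (hcont.tendsto 0).mono_left nhdsWithin_le_nhds
  rw [hc]
  refine ge_of_tendsto hlim ?_
  filter_upwards [Ioc_mem_nhdsGT (zero_lt_one' ℝ)] with t ht
  refine (iInf₂_le ((1 - t) * y + t * z) ?_).trans (legendre_segment_le ht.1.le ht.2 hyc hzc)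
  have h1 : 0 ≤ (1 - t) * (y - u) := mul_nonneg (by linarith [ht.2]) (by linarith [hy.1])
  have h2 : 0 ≤ (1 - t) * (v - y) := mul_nonneg (by linarith [ht.2]) (by linarith [hy.2])
  have h3 : 0 < t * (z - u) := mul_pos ht.1 (by linarith [hz.1])
  have h4 : 0 < t * (v - z) := mul_pos ht.1 (by linarith [hz.2])
  constructor <;> linarith

theorem SatisfiesLDP.tendsto_of_iInf_le {X : Type*} [TopologicalSpace X] [MeasurableSpace X]
    {μ : α → Measure X} {I : X → EReal} (h : SatisfiesLDP l a μ I) (ha : Tendsto a l atTop)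
    {U C : Set X} (hU : IsOpen U) (hC : IsClosed C) (hUC : U ⊆ C)
    (hI : ⨅ x ∈ U, I x ≤ ⨅ x ∈ C, I x) :
    Tendsto (fun n => -(ENNReal.log (μ n C) / (a n : EReal))) l (𝓝 (⨅ x ∈ C, I x)) := by
  have : Tendsto (fun n => ENNReal.log (μ n C) / (a n : EReal)) l (𝓝 (-⨅ x ∈ C, I x)) := by
    refine tendsto_of_le_liminf_of_limsup_le ?_ (h.upper_bound C hC)
    refine (EReal.neg_le_neg_iff.2 hI).trans ((h.lower_bound U hU).trans ?_)
    refine liminf_le_liminf ?_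
    filter_upwards [ha.eventually_ge_atTop 0] with n hn
    exact EReal.div_le_div_right_of_nonneg (by exact_mod_cast hn)
      (ENNReal.log_le_log (measure_mono hUC))
  simpa [Function.comp_def] using (continuous_neg.tendsto _).comp this

theorem SatisfiesLDP.isLocalRate_legendre {F : ℝ → ℝ} (h0 : F 0 = 0)
    (h : SatisfiesLDP l a μ (legendre F)) (ha : Tendsto a l atTop) :
    IsLocalRate l a μ (legendre F) := by
  intro x
  refine ⟨fun ε => ⨅ z ∈ Set.Icc (x - ε) (x + ε), legendre F z, ?_, ?_⟩
  · suffices ∀ᶠ ε in 𝓝[>] (0 : ℝ), ⨅ z ∈ Set.Ioo (x - ε) (x + ε), legendre F z ≤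
        ⨅ z ∈ Set.Icc (x - ε) (x + ε), legendre F z from
      this.mono fun ε hε => h.tendsto_of_iInf_le ha isOpen_Ioo isClosed_Icc
        Set.Ioo_subset_Icc_self hε
    -- Either every open interval around `x` contains a point of finite rate, or the rate is `⊤`
    -- near `x` and both infima are `⊤` for small `ε`.
    by_cases hx : ∃ᶠ z in 𝓝 x, legendre F z < ⊤
    · filter_upwards [self_mem_nhdsWithin] with ε hε
      have hmem : Set.Ioo (x - ε) (x + ε) ∈ 𝓝 x :=
        Ioo_mem_nhds (sub_lt_self _ hε) (lt_add_of_pos_right _ hε)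
      obtain ⟨z, hz, hz'⟩ := (hx.and_eventually hmem).exists
      exact iInf_Ioo_le_iInf_Icc h0 hz' hz
    · rw [not_frequently, Metric.nhds_basis_closedBall.eventually_iff] at hx
      obtain ⟨ρ, hρ, hx⟩ := hx
      filter_upwards [Ioc_mem_nhdsGT hρ] with ε hε
      refine le_iInf₂ fun z hz => ?_
      rw [← Real.closedBall_eq_Icc] at hz
      have := hx (Metric.closedBall_subset_closedBall hε.2 hz)
      rw [not_lt, top_le_iff] at this
      rw [this]
      exact le_top
  · refine tendsto_order.2 ⟨fun b hb => ?_, fun b hb => ?_⟩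
    · obtain ⟨b', hbb, hb'⟩ := exists_between hb
      have hev := lowerSemicontinuous_legendre F x b' hb'
      rw [Metric.nhds_basis_closedBall.eventually_iff] at hev
      obtain ⟨ρ, hρ, hx⟩ := hev
      filter_upwards [Ioc_mem_nhdsGT hρ] with ε hε
      refine hbb.trans_le (le_iInf₂ fun z hz => ?_)
      rw [← Real.closedBall_eq_Icc] at hz
      exact (hx (Metric.closedBall_subset_closedBall hε.2 hz)).le
    · filter_upwards [self_mem_nhdsWithin] with ε hε
      refine (iInf₂_le x ?_).trans_lt hb
      have : 0 < ε := hε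
      constructor <;> linarith

end LargeDeviations

end MultIsing

noncomputable section

namespace MultIsing

/-! ### Transfer operator and bounds on chain partition functions -/

section Transfer

/-- The transfer operator of the one-dimensional chain: `(T g) s = 𝔼 (exp (β s τ) g τ)` for a spin
`τ` which is `+1` with probability `r`. -/
def transfer (r β : ℝ) (g : ℤˣ → ℝ) (s : ℤˣ) : ℝ :=
  r * (Real.exp (β * ((s : ℤ) : ℝ)) * g 1) + (1 - r) * (Real.exp (-(β * ((s : ℤ) : ℝ))) * g (-1))

/-- The partition function of an open chain with `k` bonds. -/
def chainPartition (r β : ℝ) (k : ℕ) : ℝ :=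
  r * (transfer r β)^[k] 1 1 + (1 - r) * (transfer r β)^[k] 1 (-1)

variable {r : ℝ}

theorem transfer_mono (hr0 : 0 < r) (hr1 : r < 1) (β : ℝ) : Monotone (transfer r β) := by
  intro f g hfg s
  have h1 := hfg 1
  have h2 := hfg (-1)
  have : 0 < 1 - r := sub_pos.2 hr1
  unfold transfer
  gcongr

theorem transfer_smul (r β c : ℝ) (g : ℤˣ → ℝ) : transfer r β (c • g) = c • transfer r β g := by
  ext s
  simp only [transfer, Pi.smul_apply, smul_eq_mul]
  ring

theorem iterate_transfer_smul (r β c : ℝ) (k : ℕ) (g : ℤˣ → ℝ) :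
    (transfer r β)^[k] (c • g) = c • (transfer r β)^[k] g :=
  (Function.Semiconj.iterate_right (f := fun g : ℤˣ → ℝ => c • g)
    (fun g => (transfer_smul r β c g).symm) k g).symm

theorem abs_spin (s : ℤˣ) : |((s : ℤ) : ℝ)| = 1 := by
  rcases Int.units_eq_one_or s with rfl | rfl <;> simp

theorem iterate_transfer_pos (hr0 : 0 < r) (hr1 : r < 1) (β : ℝ) (k : ℕ) (s : ℤˣ) :
    0 < (transfer r β)^[k] 1 s := by
  have h1r : 0 < 1 - r := sub_pos.2 hr1
  induction k generalizing s with
  | zero => simp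
  | succ k ih =>
    rw [Function.iterate_succ_apply', transfer]
    have h1 := ih 1
    have h2 := ih (-1)
    positivity

theorem chainPartition_pos (hr0 : 0 < r) (hr1 : r < 1) (β : ℝ) (k : ℕ) :
    0 < chainPartition r β k := by
  have h1r : 0 < 1 - r := sub_pos.2 hr1
  have h1 := iterate_transfer_pos hr0 hr1 β k 1
  have h2 := iterate_transfer_pos hr0 hr1 β k (-1)
  unfold chainPartition
  positivity

@[simp]
theorem chainPartition_zero (r β : ℝ) : chainPartition r β 0 = 1 := by
  simp [chainPartition]

theorem chainPartition_le_of_le (hr0 : 0 < r) (hr1 : r < 1) {β β' c : ℝ} {k k' : ℕ}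
    (h : (transfer r β)^[k] 1 ≤ c • (transfer r β')^[k'] 1) :
    chainPartition r β k ≤ c * chainPartition r β' k' := by
  have h1r : 0 < 1 - r := sub_pos.2 hr1
  have h1 := mul_le_mul_of_nonneg_left (h 1) hr0.le
  have h2 := mul_le_mul_of_nonneg_left (h (-1)) h1r.le
  simp only [Pi.smul_apply, smul_eq_mul] at h1 h2
  unfold chainPartition
  linarith

theorem transfer_one_le (hr0 : 0 < r) (hr1 : r < 1) (β : ℝ) :
    transfer r β 1 ≤ Real.exp |β| • 1 := by
  intro s
  have h1r : 0 < 1 - r := sub_pos.2 hr1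
  have hs : |β * ((s : ℤ) : ℝ)| = |β| := by rw [abs_mul, abs_spin, mul_one]
  have h1 := Real.exp_le_exp.2 ((le_abs_self _).trans hs.le)
  have h2 := Real.exp_le_exp.2 ((neg_le_abs _).trans hs.le)
  simp only [transfer, Pi.one_apply, mul_one, Pi.smul_apply, smul_eq_mul]
  calc _ ≤ r * Real.exp |β| + (1 - r) * Real.exp |β| := by gcongr
    _ = _ := by ring

theorem le_transfer_one (hr0 : 0 < r) (hr1 : r < 1) (β : ℝ) :
    1 ≤ Real.exp |β| • transfer r β 1 := by
  intro s
  have h1r : 0 < 1 - r := sub_pos.2 hr1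
  have hs : |β * ((s : ℤ) : ℝ)| = |β| := by rw [abs_mul, abs_spin, mul_one]
  have h1 : 1 ≤ Real.exp |β| * Real.exp (β * ((s : ℤ) : ℝ)) := by
    rw [← Real.exp_add]
    exact Real.one_le_exp (by linarith [neg_abs_le (β * ((s : ℤ) : ℝ))])
  have h2 : 1 ≤ Real.exp |β| * Real.exp (-(β * ((s : ℤ) : ℝ))) := by
    rw [← Real.exp_add]
    exact Real.one_le_exp (by linarith [le_abs_self (β * ((s : ℤ) : ℝ))])
  simp only [transfer, Pi.one_apply, mul_one, Pi.smul_apply, smul_eq_mul]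
  have h3 := mul_le_mul_of_nonneg_left h1 hr0.le
  have h4 := mul_le_mul_of_nonneg_left h2 h1r.le
  linarith

/-- The extra bond is the innermost application, to the constant `1`; monotonicity carries the
one-step bound through the other `k`. -/
theorem chainPartition_succ_le (hr0 : 0 < r) (hr1 : r < 1) (β : ℝ) (k : ℕ) :
    chainPartition r β (k + 1) ≤ Real.exp |β| * chainPartition r β k := by
  refine chainPartition_le_of_le hr0 hr1 ?_
  rw [Function.iterate_succ_apply, ← iterate_transfer_smul]
  exact (transfer_mono hr0 hr1 β).iterate k (transfer_one_le hr0 hr1 β)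

theorem chainPartition_le_succ (hr0 : 0 < r) (hr1 : r < 1) (β : ℝ) (k : ℕ) :
    chainPartition r β k ≤ Real.exp |β| * chainPartition r β (k + 1) := by
  refine chainPartition_le_of_le hr0 hr1 ?_
  rw [Function.iterate_succ_apply, ← iterate_transfer_smul]
  exact (transfer_mono hr0 hr1 β).iterate k (le_transfer_one hr0 hr1 β)

theorem transfer_le_transfer (hr0 : 0 < r) (hr1 : r < 1) (β β' : ℝ) {g : ℤˣ → ℝ} (hg : 0 ≤ g) :
    transfer r β g ≤ Real.exp |β - β'| • transfer r β' g := by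
  intro s
  have h1r : 0 < 1 - r := sub_pos.2 hr1
  have hs : |(β - β') * ((s : ℤ) : ℝ)| = |β - β'| := by rw [abs_mul, abs_spin, mul_one]
  have h1 : Real.exp (β * ((s : ℤ) : ℝ)) ≤ Real.exp |β - β'| * Real.exp (β' * ((s : ℤ) : ℝ)) := by
    rw [← Real.exp_add]
    exact Real.exp_le_exp.2 (by linarith [le_abs_self ((β - β') * ((s : ℤ) : ℝ))])
  have h2 : Real.exp (-(β * ((s : ℤ) : ℝ))) ≤
      Real.exp |β - β'| * Real.exp (-(β' * ((s : ℤ) : ℝ))) := by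
    rw [← Real.exp_add]
    exact Real.exp_le_exp.2 (by linarith [neg_abs_le ((β - β') * ((s : ℤ) : ℝ))])
  have h3 := mul_le_mul_of_nonneg_left (mul_le_mul_of_nonneg_right h1 (hg 1)) hr0.le
  have h4 := mul_le_mul_of_nonneg_left (mul_le_mul_of_nonneg_right h2 (hg (-1))) h1r.le
  simp only [transfer, Pi.smul_apply, smul_eq_mul]
  linarith

theorem iterate_transfer_le (hr0 : 0 < r) (hr1 : r < 1) (β β' : ℝ) (k : ℕ) :
    (transfer r β)^[k] 1 ≤ Real.exp (k * |β - β'|) • (transfer r β')^[k] 1 := by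
  induction k with
  | zero => simp
  | succ k ih =>
    rw [Function.iterate_succ_apply', Function.iterate_succ_apply']
    refine (transfer_le_transfer hr0 hr1 β β'
      fun s => (iterate_transfer_pos hr0 hr1 β k s).le).trans ?_
    have := transfer_mono hr0 hr1 β' ih
    rw [transfer_smul] at this
    refine (smul_le_smul_of_nonneg_left this (Real.exp_nonneg _)).trans_eq ?_
    rw [smul_smul, ← Real.exp_add]
    push_cast
    ring_nf

theorem differentiable_iterate_transfer (r : ℝ) (k : ℕ) (s : ℤˣ) :
    Differentiable ℝ fun β => (transfer r β)^[k] 1 s := by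
  induction k generalizing s with
  | zero => simp
  | succ k ih =>
    simp only [Function.iterate_succ_apply', transfer]
    have h1 := ih 1
    have h2 := ih (-1)
    fun_prop

theorem differentiable_log_chainPartition (hr0 : 0 < r) (hr1 : r < 1) (k : ℕ) :
    Differentiable ℝ fun β => Real.log (chainPartition r β k) := by
  have h1 := differentiable_iterate_transfer r k 1
  have h2 := differentiable_iterate_transfer r k (-1)
  refine Differentiable.log ?_ fun β => (chainPartition_pos hr0 hr1 β k).ne'
  unfold chainPartition
  fun_prop

/-- Changing `β` alters each of the `k` bond weights by a factor at most `exp |β - β'|`. This yields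
derivative bounds summable against `P⁻ᵏ`. -/
theorem lipschitzWith_log_chainPartition (hr0 : 0 < r) (hr1 : r < 1) (k : ℕ) :
    LipschitzWith k fun β => Real.log (chainPartition r β k) := by
  refine LipschitzWith.of_le_add_mul _ fun β β' => ?_
  have h := Real.log_le_log (chainPartition_pos hr0 hr1 β k)
    (chainPartition_le_of_le hr0 hr1 (iterate_transfer_le hr0 hr1 β β' k))
  rw [Real.log_mul (Real.exp_pos _).ne' (chainPartition_pos hr0 hr1 β' k).ne', Real.log_exp] at h
  simpa [Real.dist_eq, add_comm] using h

/-- The free energy increment from adding one bond to a chain with `k` bonds. -/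
def chainIncrement (r β : ℝ) (k : ℕ) : ℝ :=
  Real.log (chainPartition r β (k + 1)) - Real.log (chainPartition r β k)

theorem log_chainPartition_eq_sum (r β : ℝ) (k : ℕ) :
    Real.log (chainPartition r β k) = ∑ i ∈ Finset.range k, chainIncrement r β i := by
  simp [chainIncrement, Finset.sum_range_sub fun i => Real.log (chainPartition r β i)]

theorem abs_chainIncrement_le (hr0 : 0 < r) (hr1 : r < 1) (β : ℝ) (k : ℕ) :
    |chainIncrement r β k| ≤ |β| := by
  have hk := chainPartition_pos hr0 hr1 β k
  have hk1 := chainPartition_pos hr0 hr1 β (k + 1)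
  have h1 := Real.log_le_log hk1 (chainPartition_succ_le hr0 hr1 β k)
  have h2 := Real.log_le_log hk (chainPartition_le_succ hr0 hr1 β k)
  rw [Real.log_mul (Real.exp_pos _).ne' hk.ne', Real.log_exp] at h1
  rw [Real.log_mul (Real.exp_pos _).ne' hk1.ne', Real.log_exp] at h2
  rw [abs_le, chainIncrement]
  constructor <;> linarith

theorem differentiable_chainIncrement (hr0 : 0 < r) (hr1 : r < 1) (k : ℕ) :
    Differentiable ℝ fun β => chainIncrement r β k :=
  (differentiable_log_chainPartition hr0 hr1 (k + 1)).sub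
    (differentiable_log_chainPartition hr0 hr1 k)

theorem abs_deriv_chainIncrement_le (hr0 : 0 < r) (hr1 : r < 1) (k : ℕ) (β : ℝ) :
    |deriv (fun β => chainIncrement r β k) β| ≤ 2 * k + 1 := by
  unfold chainIncrement
  rw [deriv_fun_sub (differentiable_log_chainPartition hr0 hr1 (k + 1) β)
    (differentiable_log_chainPartition hr0 hr1 k β)]
  have h1 := norm_deriv_le_of_lipschitz (x₀ := β) (lipschitzWith_log_chainPartition hr0 hr1 (k + 1))
  have h2 := norm_deriv_le_of_lipschitz (x₀ := β) (lipschitzWith_log_chainPartition hr0 hr1 k)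
  refine (abs_sub _ _).trans ?_
  rw [Real.norm_eq_abs] at h1 h2
  push_cast at h1 h2
  linarith

end Transfer

/-! ### Explicit partition functions -/

section ClosedForm

variable {r : ℝ}

theorem sqrt_mul_exp_field (hr0 : 0 < r) (hr1 : r < 1) :
    √(r * (1 - r)) * Real.exp (field r) = r := by
  have h1r : 0 < 1 - r := sub_pos.2 hr1
  have h : Real.exp (field r) ^ 2 = r / (1 - r) := by
    rw [← Real.exp_nat_mul, field]
    push_cast
    rw [← mul_assoc, mul_one_div_cancel two_ne_zero, one_mul, Real.exp_log (by positivity)]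
  rw [← sq_eq_sq₀ (by positivity) hr0.le, mul_pow, h, Real.sq_sqrt (by positivity)]
  field_simp

theorem sqrt_mul_exp_neg_field (hr0 : 0 < r) (hr1 : r < 1) :
    √(r * (1 - r)) * Real.exp (-field r) = 1 - r := by
  have h1r : 0 < 1 - r := sub_pos.2 hr1
  have hc : √(r * (1 - r)) ^ 2 = r * (1 - r) := Real.sq_sqrt (by positivity)
  have h := sqrt_mul_exp_field hr0 hr1
  have he : Real.exp (field r) * Real.exp (-field r) = 1 := by rw [← Real.exp_add]; simp
  have : r * (√(r * (1 - r)) * Real.exp (-field r)) = r * (1 - r) := by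
    calc _ = √(r * (1 - r)) * Real.exp (field r) * (√(r * (1 - r)) * Real.exp (-field r)) := by
          rw [h]
      _ = √(r * (1 - r)) ^ 2 * (Real.exp (field r) * Real.exp (-field r)) := by ring
      _ = _ := by rw [he, hc, mul_one]
  exact mul_left_cancel₀ hr0.ne' this

theorem two_mul_sqrt_mul_cosh_field (hr0 : 0 < r) (hr1 : r < 1) :
    2 * √(r * (1 - r)) * Real.cosh (field r) = 1 := by
  rw [Real.cosh_eq]
  linarith [sqrt_mul_exp_field hr0 hr1, sqrt_mul_exp_neg_field hr0 hr1]

/-- The square root `√(sinh² h + e^{-4β})` in the eigenvalues. -/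
def discr (r β : ℝ) : ℝ := √(Real.sinh (field r) ^ 2 + Real.exp (-4 * β))

theorem discr_sq (r β : ℝ) :
    discr r β ^ 2 = Real.sinh (field r) ^ 2 + Real.exp (-2 * β) ^ 2 := by
  rw [discr, Real.sq_sqrt (by positivity), ← Real.exp_nat_mul]
  ring_nf

theorem abs_sinh_lt_discr (r β : ℝ) : |Real.sinh (field r)| < discr r β := by
  rw [discr]
  refine Real.lt_sqrt_of_sq_lt ?_
  rw [sq_abs]
  exact lt_add_of_pos_right _ (Real.exp_pos _)

theorem discr_pos (r β : ℝ) : 0 < discr r β := (abs_nonneg _).trans_lt (abs_sinh_lt_discr r β)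

theorem exp_neg_eq (β : ℝ) : Real.exp (-β) = Real.exp β * Real.exp (-2 * β) := by
  rw [← Real.exp_add]
  ring_nf

theorem inner_vVec_wPlus (r β : ℝ) : inner ℝ (vVec r) (wPlus r β) =
    Real.exp β * (Real.exp (-field r / 2) * (Real.sinh (field r) - discr r β)
      - Real.exp (field r / 2) * Real.exp (-2 * β)) := by
  simp only [vVec, wPlus, lamPlus, PiLp.inner_apply, Fin.sum_univ_two]
  simp only [RCLike.inner_apply, conj_trivial, Matrix.cons_val_zero, Matrix.cons_val_one,
    Matrix.cons_val_fin_one]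
  rw [exp_neg_eq, Real.exp_add, ← Real.cosh_add_sinh (field r), discr]
  ring

theorem norm_wPlus_sq (r β : ℝ) : ‖wPlus r β‖ ^ 2 =
    Real.exp β ^ 2 * (2 * discr r β * (discr r β - Real.sinh (field r))) := by
  rw [EuclideanSpace.real_norm_sq_eq]
  simp only [wPlus, lamPlus, Fin.sum_univ_two, Matrix.cons_val_zero, Matrix.cons_val_one,
    Matrix.cons_val_fin_one]
  have := discr_sq r β
  rw [exp_neg_eq, Real.exp_add, ← Real.cosh_add_sinh (field r), ← discr]
  linear_combination -Real.exp β ^ 2 * this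

/-- Clearing the normalization of the eigenvector removes the half-field exponentials, leaving an
expression fit for polynomial identities. -/
theorem overlapSq_eq (r β : ℝ) : overlapSq r β =
    Real.cosh (field r) + (Real.sinh (field r) ^ 2 + Real.exp (-2 * β)) / discr r β := by
  have hR := discr_pos r β
  have hRs : 0 < discr r β - Real.sinh (field r) :=
    sub_pos.2 ((le_abs_self _).trans_lt (abs_sinh_lt_discr r β))
  have hb : Real.exp (field r / 2) ^ 2 = Real.cosh (field r) + Real.sinh (field r) := by
    rw [← Real.exp_nat_mul, Real.cosh_add_sinh]
    ring_nf
  have hb' : Real.exp (-field r / 2) ^ 2 = Real.cosh (field r) - Real.sinh (field r) := by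
    rw [← Real.exp_nat_mul, Real.cosh_sub_sinh]
    ring_nf
  have hbb : Real.exp (field r / 2) * Real.exp (-field r / 2) = 1 := by
    rw [← Real.exp_add]
    ring_nf
    simp
  have hsq := discr_sq r β
  have hE := Real.exp_pos β
  rw [overlapSq, ePlus, inner_smul_right, sq_abs, mul_pow, inv_pow, norm_wPlus_sq,
    inner_vVec_wPlus]
  generalize Real.exp (field r / 2) = b at *
  generalize Real.exp (-field r / 2) = b' at *
  generalize Real.exp (-2 * β) = q at *
  generalize Real.cosh (field r) = C at *
  generalize Real.sinh (field r) = s at *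
  generalize discr r β = R at *
  field_simp
  -- The factor `R - s` cancels the one in `‖wPlus r β‖ ^ 2`.
  have key : (b' * (s - R) - b * q) ^ 2 = (R - s) * (2 * (C * R + (s ^ 2 + q))) := by
    have : q ^ 2 = R ^ 2 - s ^ 2 := by linarith
    linear_combination (s - R) ^ 2 * hb' + q ^ 2 * hb - 2 * q * (s - R) * hbb + (C + s) * this
  rw [key]
  ring

theorem overlapSq_pos (r β : ℝ) : 0 < overlapSq r β := by
  rw [overlapSq_eq]
  have := discr_pos r β
  have := Real.cosh_pos (field r)
  positivity

theorem lamPlus_pos (r β : ℝ) : 0 < lamPlus r β := by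
  have := discr_pos r β
  have := Real.cosh_pos (field r)
  rw [lamPlus, ← discr]
  positivity

theorem chainPartition_one (r β : ℝ) : chainPartition r β 1 =
    Real.exp β * (r ^ 2 + (1 - r) ^ 2) + 2 * r * (1 - r) * Real.exp (-β) := by
  simp [chainPartition, transfer]
  ring

/-- Cayley–Hamilton for the 2×2 transfer matrix, whose trace is `exp β`. -/
theorem chainPartition_add_two (r β : ℝ) (k : ℕ) : chainPartition r β (k + 2) =
    Real.exp β * chainPartition r β (k + 1)
      - r * (1 - r) * (Real.exp β ^ 2 - Real.exp (-β) ^ 2) * chainPartition r β k := by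
  simp only [chainPartition, Function.iterate_succ_apply', transfer]
  generalize (transfer r β)^[k] 1 1 = u
  generalize (transfer r β)^[k] 1 (-1) = v
  simp only [Units.val_one, Int.cast_one, mul_one, Units.val_neg, Int.cast_neg, mul_neg, neg_neg]
  ring

/-- Both sides satisfy the same two-term recursion, since `√(r(1-r)) Λ_±` are its characteristic
roots (`hX`, `hY`), and they agree at `k = 0, 1`. No diagonalization is carried out. -/
theorem chainPartition_eq (hr0 : 0 < r) (hr1 : r < 1) (β : ℝ) (k : ℕ) : chainPartition r β k =
    √(r * (1 - r)) ^ (k + 1) * (overlapSq r β * lamPlus r β ^ k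
      + (2 * Real.cosh (field r) - overlapSq r β) * lamMinus r β ^ k) := by
  have hc := two_mul_sqrt_mul_cosh_field hr0 hr1
  have hc2 : √(r * (1 - r)) ^ 2 = r * (1 - r) :=
    Real.sq_sqrt (mul_nonneg hr0.le (sub_nonneg.2 hr1.le))
  have hsq := discr_sq r β
  have hcs := Real.cosh_sq (field r)
  have hrec := chainPartition_add_two r β
  have hone := chainPartition_one r β
  have hov := overlapSq_eq r β
  have hR := discr_pos r β
  rw [exp_neg_eq] at hone
  simp only [exp_neg_eq] at hrec
  rw [lamPlus, lamMinus, ← discr]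
  generalize √(r * (1 - r)) = c at *
  generalize Real.exp (-2 * β) = q at *
  generalize Real.cosh (field r) = C at *
  generalize Real.sinh (field r) = s at *
  generalize discr r β = R at *
  generalize Real.exp β = E at *
  generalize overlapSq r β = v at *
  have hv : (v - C) * R = s ^ 2 + q := by rw [hov]; field_simp; ring
  have hcc : c = 2 * c ^ 2 * C := by linear_combination -c * hc
  induction k using Nat.twoStepInduction with
  | zero =>
    rw [chainPartition_zero]
    linear_combination -hc
  | one =>
    rw [hone]
    linear_combination (2 * E - 2 * E * q) * hc2 - 2 * c ^ 2 * E * hv + 2 * c ^ 2 * E * hcs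
      - E * (2 * c * C + 1) * hc
  | more k ih1 ih2 =>
    rw [hrec, ih1, ih2]
    have hX : c ^ 2 * (E * (C + R)) ^ 2 =
        E * c * (E * (C + R)) - r * (1 - r) * (E ^ 2 - (E * q) ^ 2) := by
      linear_combination -(E ^ 2 * (C + R)) * hcc - (E ^ 2 - (E * q) ^ 2) * hc2
        + c ^ 2 * E ^ 2 * hsq - c ^ 2 * E ^ 2 * hcs
    have hY : c ^ 2 * (E * (C - R)) ^ 2 =
        E * c * (E * (C - R)) - r * (1 - r) * (E ^ 2 - (E * q) ^ 2) := by
      linear_combination -(E ^ 2 * (C - R)) * hcc - (E ^ 2 - (E * q) ^ 2) * hc2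
        + c ^ 2 * E ^ 2 * hsq - c ^ 2 * E ^ 2 * hcs
    linear_combination -(c ^ (k + 1) * v * (E * (C + R)) ^ k) * hX
      - (c ^ (k + 1) * (2 * C - v) * (E * (C - R)) ^ k) * hY

theorem log_chainPartition_eq (hr0 : 0 < r) (hr1 : r < 1) (β : ℝ) (k : ℕ) :
    Real.log (chainPartition r β k) = (k + 1) / 2 * Real.log (r * (1 - r))
      + k * Real.log (lamPlus r β) + Real.log (overlapSq r β)
      + Real.log (1 + (2 * Real.cosh (field r) / overlapSq r β - 1) *
        (lamMinus r β / lamPlus r β) ^ k) := by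
  have hv := overlapSq_pos r β
  have hL := lamPlus_pos r β
  have hrr : 0 < r * (1 - r) := mul_pos hr0 (sub_pos.2 hr1)
  have hs : 0 < √(r * (1 - r)) := Real.sqrt_pos.2 hrr
  have hZ := chainPartition_pos hr0 hr1 β k
  have heq : chainPartition r β k = √(r * (1 - r)) ^ (k + 1) * lamPlus r β ^ k * overlapSq r β *
      (1 + (2 * Real.cosh (field r) / overlapSq r β - 1) * (lamMinus r β / lamPlus r β) ^ k) := by
    rw [chainPartition_eq hr0 hr1, div_pow]
    field_simp
  -- `Λ_-` may be negative, so positivity is inferred from that of the partition function.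
  have hpos : 0 < 1 + (2 * Real.cosh (field r) / overlapSq r β - 1) *
      (lamMinus r β / lamPlus r β) ^ k := by
    rw [heq] at hZ
    exact (pos_iff_pos_of_mul_pos hZ).1 (by positivity)
  rw [heq, Real.log_mul (by positivity) hpos.ne', Real.log_mul (by positivity) hv.ne',
    Real.log_mul (by positivity) (by positivity), Real.log_pow, Real.log_pow, Real.log_sqrt hrr.le]
  push_cast
  ring

end ClosedForm

end MultIsing

end

noncomputable section

namespace MultIsing

instance : MeasurableSingletonClass ℤˣ where
  measurableSet_singleton s := ⟨{(s : ℤ)}, .singleton _, by ext t; simp [Units.ext_iff]⟩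

/-! ### Independence of disjoint blocks of spins -/

section Independence

/-- Injectivity pushes the product measure to the one indexed by `ι × κ`; currying turns that into a
product of product measures. -/
theorem iIndepFun_blocks {ι κ S E : Type*} [MeasurableSpace E] (m : Measure E)
    [IsProbabilityMeasure m] {f : ι × κ → S} (hf : Function.Injective f) :
    iIndepFun (fun i (ω : S → E) k => ω (f (i, k))) (Measure.infinitePi fun _ : S => m) := by
  rw [iIndepFun_iff_map_fun_eq_infinitePi_map (by fun_prop)]
  have h1 : ∀ i, (Measure.infinitePi fun _ : S => m).map (fun ω k => ω (f (i, k))) =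
      Measure.infinitePi fun _ : κ => m := fun i =>
    Measure.map_infinitePi_infinitePi_of_inj (P := fun _ => m) (f := fun k => f (i, k))
      fun k k' h => (Prod.ext_iff.1 (hf h)).2
  simp_rw [h1]
  have h2 := Measure.infinitePi_map_curry (X := E) (fun (_ : ι) (_ : κ) => m)
  rw [← Measure.map_infinitePi_infinitePi_of_inj (P := fun _ : S => m) hf,
    Measure.map_map (by fun_prop) (by fun_prop)] at h2
  exact h2

theorem integral_prod_blocks {ι κ S E : Type*} [MeasurableSpace E] (m : Measure E)
    [IsProbabilityMeasure m] {f : ι × κ → S} (hf : Function.Injective f) (B : Finset ι)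
    {g : ι → (κ → E) → ℝ} (hg : ∀ i, Measurable (g i)) :
    ∫ ω, ∏ i ∈ B, g i (fun k => ω (f (i, k))) ∂(Measure.infinitePi fun _ : S => m) =
      ∏ i ∈ B, ∫ x, g i x ∂(Measure.infinitePi fun _ : κ => m) := by
  have hind := ((iIndepFun_blocks m hf).comp g hg).precomp
    (Subtype.val_injective (p := fun i => i ∈ B))
  have hmeas : ∀ i, Measurable fun (ω : S → E) => g i (fun k => ω (f (i, k))) := fun i =>
    (hg i).comp (by fun_prop)
  have h := hind.integral_fun_prod_eq_prod_integral fun i => (hmeas i).aestronglyMeasurable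
  simp only [Function.comp_def] at h
  have hL : ∀ ω : S → E, ∏ i ∈ B, g i (fun k => ω (f (i, k))) =
      ∏ i : B, g i (fun k => ω (f (i, k))) := fun ω =>
    (Finset.prod_coe_sort B fun i => g i (fun k => ω (f (i, k)))).symm
  simp_rw [hL]
  rw [h, ← Finset.prod_coe_sort B]
  refine Finset.prod_congr rfl fun i _ => ?_
  rw [← Measure.map_infinitePi_infinitePi_of_inj (P := fun _ : S => m)
    (f := fun k => f (i.1, k)) fun k k' h => (Prod.ext_iff.1 (hf h)).2, integral_map
    (Measurable.aemeasurable (by fun_prop)) (hg i).aestronglyMeasurable]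

end Independence

/-! ### Integrating out a one-dimensional chain -/

section Chain

theorem measurable_of_dependsOn_finset {H : (ℕ → ℤˣ) → ℝ} {s : Finset ℕ}
    (hH : DependsOn H (s : Set ℕ)) : Measurable H := by
  obtain ⟨φ, rfl⟩ := dependsOn_iff_exists_comp.1 hH
  exact (Measurable.of_discrete (f := φ)).comp (by fun_prop)

theorem integrable_of_dependsOn_finset {H : (ℕ → ℤˣ) → ℝ} {s : Finset ℕ}
    (hH : DependsOn H (s : Set ℕ)) (μ : Measure (ℕ → ℤˣ)) [IsFiniteMeasure μ] :
    Integrable H μ := by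
  obtain ⟨φ, rfl⟩ := dependsOn_iff_exists_comp.1 hH
  exact (Integrable.of_finite (f := φ)).comp_measurable (by fun_prop)

variable (r : unitInterval)

theorem integral_eval_bernoulli (n : ℕ) (G : ℤˣ → ℝ) :
    ∫ x, G (x n) ∂(Measure.infinitePi fun _ : ℕ => bernoulliMeasure (1 : ℤˣ) (-1) r) =
      r * G 1 + (1 - r) * G (-1) := by
  have h := Measure.infinitePi_map_eval (fun _ : ℕ => bernoulliMeasure (1 : ℤˣ) (-1) r) n
  have h2 := integral_bernoulliMeasure (1 : ℤˣ) (-1) r G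
  rw [← h, integral_map (Measurable.aemeasurable (by fun_prop))
    (Measurable.of_discrete).aestronglyMeasurable] at h2
  simpa using h2

theorem integral_mul_eval_of_dependsOn {H : (ℕ → ℤˣ) → ℝ} {s : Finset ℕ} {n : ℕ} (hn : n ∉ s)
    (hH : DependsOn H (s : Set ℕ)) (G : ℤˣ → ℝ) :
    ∫ x, H x * G (x n) ∂(Measure.infinitePi fun _ : ℕ => bernoulliMeasure (1 : ℤˣ) (-1) r) =
      (∫ x, H x ∂(Measure.infinitePi fun _ : ℕ => bernoulliMeasure (1 : ℤˣ) (-1) r)) *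
        (r * G 1 + (1 - r) * G (-1)) := by
  have hHm := measurable_of_dependsOn_finset hH
  obtain ⟨φ, rfl⟩ := dependsOn_iff_exists_comp.1 hH
  have hi : iIndepFun (fun (i : ℕ) (x : ℕ → ℤˣ) => x i)
      (Measure.infinitePi fun _ : ℕ => bernoulliMeasure (1 : ℤˣ) (-1) r) :=
    iIndepFun_infinitePi (X := fun _ x => x) fun _ => measurable_id
  have h := (hi.indepFun_finset s {n} (by simpa using hn) (by fun_prop)).comp
    (φ := φ) (ψ := fun y => G (y ⟨n, by simp⟩)) Measurable.of_discrete Measurable.of_discrete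
  rw [← integral_eval_bernoulli r n G]
  exact h.integral_fun_mul_eq_mul_integral hHm.aestronglyMeasurable
    ((Measurable.of_discrete (f := G)).comp (measurable_pi_apply n)).aestronglyMeasurable

theorem integral_eval_of_dependsOn {K : (ℕ → ℤˣ) → ℤˣ → ℝ} {s : Finset ℕ} {n : ℕ} (hn : n ∉ s)
    (hK : ∀ t, DependsOn (fun x => K x t) (s : Set ℕ)) :
    ∫ x, K x (x n) ∂(Measure.infinitePi fun _ : ℕ => bernoulliMeasure (1 : ℤˣ) (-1) r) =
      ∫ x, (r * K x 1 + (1 - r) * K x (-1))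
        ∂(Measure.infinitePi fun _ : ℕ => bernoulliMeasure (1 : ℤˣ) (-1) r) := by
  have hsplit : ∀ x : ℕ → ℤˣ, K x (x n) =
      K x 1 * (if x n = 1 then 1 else 0) + K x (-1) * (if x n = -1 then 1 else 0) := by
    intro x
    rcases Int.units_eq_one_or (x n) with h | h <;> rw [h] <;> simp
  have hint : ∀ t, Integrable (fun x => K x t * (if x n = t then (1 : ℝ) else 0))
      (Measure.infinitePi fun _ : ℕ => bernoulliMeasure (1 : ℤˣ) (-1) r) := by
    intro t
    refine integrable_of_dependsOn_finset (s := insert n s) ?_ _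
    intro x y hxy
    have h1 := hK t (x := x) (y := y) fun i hi => hxy i (by simp [Finset.mem_coe.1 hi])
    have h2 := hxy n (by simp)
    simp only at h1
    simp only [h1, h2]
  simp_rw [hsplit]
  rw [integral_add (hint 1) (hint (-1)),
    integral_mul_eval_of_dependsOn r hn (hK 1) fun t => if t = 1 then 1 else 0,
    integral_mul_eval_of_dependsOn r hn (hK (-1)) fun t => if t = -1 then 1 else 0,
    integral_add ((integrable_of_dependsOn_finset (hK 1) _).const_mul _)
      ((integrable_of_dependsOn_finset (hK (-1)) _).const_mul _),
    integral_const_mul, integral_const_mul]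
  have h1 : (1 : ℤˣ) ≠ -1 := by decide
  simp only [if_true, if_neg h1, if_neg h1.symm]
  ring

/-- The Gibbs weight of an open chain with `k` bonds. -/
def chainWeight (β : ℝ) (k : ℕ) (x : ℕ → ℤˣ) : ℝ :=
  Real.exp (β * ∑ i ∈ Finset.range k, ((x i : ℤ) : ℝ) * ((x (i + 1) : ℤ) : ℝ))

theorem dependsOn_chainWeight (β : ℝ) (k : ℕ) :
    DependsOn (chainWeight β k) (Finset.range (k + 1) : Set ℕ) := by
  intro x y hxy
  unfold chainWeight
  congr 2
  refine Finset.sum_congr rfl fun i hi => ?_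
  have hi := Finset.mem_range.1 hi
  rw [hxy i (by simp; omega), hxy (i + 1) (by simp; omega)]

theorem measurable_chainWeight (β : ℝ) (k : ℕ) : Measurable (chainWeight β k) :=
  measurable_of_dependsOn_finset (dependsOn_chainWeight β k)

/-- Averaging over the last spin replaces `g` by `transfer r β g` and removes one bond; the
induction needs arbitrary `g`. -/
theorem integral_chainWeight_mul (β : ℝ) (k : ℕ) (g : ℤˣ → ℝ) :
    ∫ x, chainWeight β k x * g (x k)
      ∂(Measure.infinitePi fun _ : ℕ => bernoulliMeasure (1 : ℤˣ) (-1) r) =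
      r * (transfer r β)^[k] g 1 + (1 - r) * (transfer r β)^[k] g (-1) := by
  induction k generalizing g with
  | zero =>
    simpa [chainWeight] using integral_eval_bernoulli r 0 g
  | succ k ih =>
    have hdep : ∀ t : ℤˣ, DependsOn (fun x => chainWeight β k x *
        (Real.exp (β * (((x k : ℤ) : ℝ) * ((t : ℤ) : ℝ))) * g t))
        (Finset.range (k + 1) : Set ℕ) := by
      intro t x y hxy
      have h1 := dependsOn_chainWeight β k hxy
      have h2 := hxy k (by simp)
      simp only [h1, h2]
    have h := integral_eval_of_dependsOn r (n := k + 1) (by simp) hdep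
    have hL : ∀ x : ℕ → ℤˣ, chainWeight β (k + 1) x * g (x (k + 1)) = chainWeight β k x *
        (Real.exp (β * (((x k : ℤ) : ℝ) * ((x (k + 1) : ℤ) : ℝ))) * g (x (k + 1))) := by
      intro x
      rw [chainWeight, Finset.sum_range_succ, mul_add, Real.exp_add, chainWeight, mul_assoc]
    simp_rw [hL]
    rw [h, Function.iterate_succ_apply, ← ih]
    congr 1
    ext x
    simp only [transfer, Units.val_one, Int.cast_one, mul_one, Units.val_neg, Int.cast_neg,
      mul_neg]
    ring

theorem integral_chainWeight (β : ℝ) (k : ℕ) :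
    ∫ x, chainWeight β k x
      ∂(Measure.infinitePi fun _ : ℕ => bernoulliMeasure (1 : ℤˣ) (-1) r) =
      chainPartition r β k := by
  simpa [chainPartition] using integral_chainWeight_mul r β k 1

end Chain

end MultIsing

end

noncomputable section

namespace MultIsing

/-! ### Decomposition of the box into chains, and counting -/

section Chains

variable {d : ℕ} {p : Fin d → ℕ+}

/-- The sites that are not multiples of `p`: the starting points of the chains `j, p j, p² j, …`. -/
def chainRoots (p : Fin d → ℕ+) : Set (Fin d → ℕ+) := (Set.range fun i => p * i)ᶜ

theorem one_le_site (i : Fin d → ℕ+) : 1 ≤ i := fun _ => one_le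

theorem mul_notMem_chainRoots (i : Fin d → ℕ+) : p * i ∉ chainRoots p := fun h => h ⟨i, rfl⟩

theorem exists_two_le (hp : p ≠ 1) : ∃ c, 2 ≤ (p c : ℕ) := by
  obtain ⟨c, hc⟩ := Function.ne_iff.1 hp
  refine ⟨c, ?_⟩
  have h1 : (p c : ℕ) ≠ 1 := fun h => hc (PNat.coe_eq_one_iff.1 h)
  have := (p c).pos
  omega

/-- Dividing by `p` strictly lowers a coordinate `c` with `p c ≥ 2`, so the descent stops. -/
theorem exists_pow_mul_chainRoot (hp : p ≠ 1) (i : Fin d → ℕ+) :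
    ∃ j ∈ chainRoots p, ∃ k : ℕ, p ^ k * j = i := by
  obtain ⟨c, hc⟩ := exists_two_le hp
  induction hn : (i c : ℕ) using Nat.strong_induction_on generalizing i with
  | _ n ih =>
    by_cases hi : i ∈ chainRoots p
    · exact ⟨i, hi, 0, by simp⟩
    · obtain ⟨i', rfl⟩ := not_not.1 hi
      have hlt : (i' c : ℕ) < n := by
        rw [← hn]
        simp only [Pi.mul_apply, PNat.mul_coe]
        have := (i' c).pos
        nlinarith
      obtain ⟨j, hj, k, hk⟩ := ih _ hlt i' rfl
      exact ⟨j, hj, k + 1, by rw [pow_succ', mul_assoc, hk]⟩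

theorem injective_pow_mul_chainRoot :
    Function.Injective fun x : chainRoots p × ℕ => p ^ x.2 * (x.1 : Fin d → ℕ+) := by
  have key : ∀ (j j' : chainRoots p) (k m : ℕ),
      p ^ k * (j : Fin d → ℕ+) = p ^ (k + m) * (j' : Fin d → ℕ+) → m = 0 := by
    intro j j' k m h
    rw [pow_add, mul_assoc, mul_right_inj] at h
    cases m with
    | zero => rfl
    | succ m =>
      rw [pow_succ', mul_assoc] at h
      exact absurd (h ▸ j.2) (mul_notMem_chainRoots _)
  rintro ⟨j, k⟩ ⟨j', k'⟩ h
  simp only at h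
  have hkk : k = k' := by
    rcases le_total k k' with hle | hle
    · obtain ⟨m, rfl⟩ := Nat.exists_eq_add_of_le hle
      rw [key j j' k m h, add_zero]
    · obtain ⟨m, rfl⟩ := Nat.exists_eq_add_of_le hle
      rw [key j' j k' m h.symm, add_zero]
  subst hkk
  rw [mul_right_inj] at h
  rw [Subtype.ext h]

theorem pow_mul_le_of_le {N j : Fin d → ℕ+} {k m : ℕ} (hkm : k ≤ m) (h : p ^ m * j ≤ N) :
    p ^ k * j ≤ N := by
  obtain ⟨n, rfl⟩ := Nat.exists_eq_add_of_le hkm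
  refine le_trans ?_ h
  rw [pow_add, mul_assoc, mul_left_comm]
  exact le_mul_of_one_le_left' (one_le_site _)

theorem not_pow_mul_le {c : Fin d} (hc : 2 ≤ (p c : ℕ)) {N : Fin d → ℕ+} {k : ℕ}
    (hk : (N c : ℕ) ≤ k) (j : Fin d → ℕ+) : ¬ p ^ k * j ≤ N := by
  intro h
  have h1 : (p c : ℕ) ^ k * (j c : ℕ) ≤ N c := by
    have := (PNat.coe_le_coe _ _).2 (h c)
    simpa using this
  have h2 : k < (p c : ℕ) ^ k := Nat.lt_pow_self (by omega)
  have h3 := (j c).pos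
  nlinarith

/-- `L j` counts the chain's sites in the box. It is also its number of bonds, since the last such
site is still paired with the next one, outside the box. -/
theorem exists_chainLength (hp : p ≠ 1) (N : Fin d → ℕ+) :
    ∃ L : (Fin d → ℕ+) → ℕ, ∀ j k, k < L j ↔ p ^ k * j ≤ N := by
  classical
  obtain ⟨c, hc⟩ := exists_two_le hp
  have hex : ∀ j, ∃ k, ¬ p ^ k * j ≤ N := fun j => ⟨N c, not_pow_mul_le hc le_rfl j⟩
  refine ⟨fun j => Nat.find (hex j), fun j k => ?_⟩
  rw [Nat.lt_find_iff]
  exact ⟨fun h => not_not.1 (h k le_rfl), fun h m hm => not_not.2 (pow_mul_le_of_le hm h)⟩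

open Classical in
/-- The roots of the chains which meet the box. -/
def boxRoots (p N : Fin d → ℕ+) : Finset (chainRoots p) :=
  (Finset.Icc 1 N).subtype fun i => i ∈ chainRoots p

theorem mem_boxRoots {N : Fin d → ℕ+} {j : chainRoots p} :
    j ∈ boxRoots p N ↔ (j : Fin d → ℕ+) ≤ N := by
  classical
  simp [boxRoots, one_le_site]

theorem sum_Icc_eq_sum_boxRoots (hp : p ≠ 1) {N : Fin d → ℕ+} {L : (Fin d → ℕ+) → ℕ}
    (hL : ∀ j k, k < L j ↔ p ^ k * j ≤ N) {A : Type*} [AddCommMonoid A] (f : (Fin d → ℕ+) → A) :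
    ∑ i ∈ Finset.Icc 1 N, f i =
      ∑ j ∈ boxRoots p N, ∑ k ∈ Finset.range (L j), f (p ^ k * j) := by
  rw [Finset.sum_sigma']
  symm
  refine Finset.sum_nbij (fun x => p ^ x.2 * (x.1 : Fin d → ℕ+)) ?_ ?_ ?_ fun _ _ => rfl
  · rintro ⟨j, k⟩ h
    simp only [Finset.mem_sigma, Finset.mem_range] at h
    exact Finset.mem_Icc.2 ⟨one_le_site _, (hL _ _).1 h.2⟩
  · rintro ⟨j, k⟩ _ ⟨j', k'⟩ _ h
    have := injective_pow_mul_chainRoot (a₁ := (j, k)) (a₂ := (j', k')) h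
    simp only [Prod.mk.injEq] at this
    rw [this.1, this.2]
  · intro i hi
    obtain ⟨j, hj, k, rfl⟩ := exists_pow_mul_chainRoot hp i
    have hi' : p ^ k * j ≤ N := (Finset.mem_Icc.1 (Finset.mem_coe.1 hi)).2
    refine ⟨⟨⟨j, hj⟩, k⟩, ?_, rfl⟩
    simp only [Finset.coe_sigma, Set.mem_sigma_iff, Finset.mem_coe, Finset.mem_range, hL,
      mem_boxRoots]
    exact ⟨by simpa using pow_mul_le_of_le (Nat.zero_le k) hi', hi'⟩

open Classical in
/-- The number of sites `i` with `p ^ k * i` in the box. -/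
def dilateCount (p N : Fin d → ℕ+) (k : ℕ) : ℕ :=
  ((Finset.Icc 1 N).filter fun i => p ^ k * i ≤ N).card

-- Among the sites `i` with `p ^ k * i ≤ N`, those that are not roots are `p * i'` with `p ^ (k + 1)
-- * i' ≤ N`.
open Classical in
theorem card_boxRoots_filter (p N : Fin d → ℕ+) (k : ℕ) :
    ((boxRoots p N).filter fun j : chainRoots p => p ^ k * (j : Fin d → ℕ+) ≤ N).card +
      dilateCount p N (k + 1) = dilateCount p N k := by
  rw [dilateCount, dilateCount, ← Finset.card_filter_add_card_filter_not
    (s := (Finset.Icc 1 N).filter fun i => p ^ k * i ≤ N) fun i => i ∈ chainRoots p]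
  congr 1
  · refine Finset.card_nbij Subtype.val ?_ Subtype.val_injective.injOn ?_
    · intro j hj
      simp only [Finset.coe_filter, Set.mem_ofPred_eq, mem_boxRoots] at hj
      simp only [Finset.coe_filter, Set.mem_ofPred_eq, Finset.mem_filter, Finset.mem_Icc]
      exact ⟨⟨⟨one_le_site _, hj.1⟩, hj.2⟩, j.2⟩
    · intro j hj
      simp only [Finset.coe_filter, Set.mem_ofPred_eq, Finset.mem_filter, Finset.mem_Icc] at hj
      refine ⟨⟨j, hj.2⟩, ?_, rfl⟩
      simp only [Finset.coe_filter, Set.mem_ofPred_eq, mem_boxRoots]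
      exact ⟨hj.1.1.2, hj.1.2⟩
  · refine Finset.card_nbij (fun i => p * i) ?_ (fun _ _ _ _ h => mul_left_cancel h) ?_
    · intro i hi
      simp only [Finset.coe_filter, Set.mem_ofPred_eq, Finset.mem_Icc] at hi
      simp only [Finset.coe_filter, Set.mem_ofPred_eq, Finset.mem_filter, Finset.mem_Icc]
      have h2 : p ^ k * (p * i) ≤ N := by rw [← mul_assoc, ← pow_succ]; exact hi.2
      exact ⟨⟨⟨one_le_site _, by simpa using pow_mul_le_of_le (Nat.zero_le k) h2⟩, h2⟩,
        mul_notMem_chainRoots i⟩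
    · intro i hi
      simp only [Finset.coe_filter, Set.mem_ofPred_eq, Finset.mem_filter, Finset.mem_Icc] at hi
      obtain ⟨i', rfl⟩ := not_not.1 hi.2
      have h2 : p ^ (k + 1) * i' ≤ N := by rw [pow_succ, mul_assoc]; exact hi.1.2
      refine ⟨i', ?_, rfl⟩
      simp only [Finset.coe_filter, Set.mem_ofPred_eq, Finset.mem_Icc]
      exact ⟨⟨one_le_site _, by simpa using pow_mul_le_of_le (Nat.zero_le _) h2⟩, h2⟩

theorem card_filter_mul_le (q n : ℕ+) :
    ((Finset.Icc 1 n).filter fun i => q * i ≤ n).card = (n : ℕ) / q := by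
  rw [← Nat.add_sub_cancel ((n : ℕ) / q) 1, ← Nat.card_Icc]
  refine Finset.card_nbij (fun i => (i : ℕ)) ?_ (fun _ _ _ _ h => PNat.coe_injective h) ?_
  · intro i hi
    simp only [Finset.coe_filter, Set.mem_ofPred_eq, Finset.mem_Icc] at hi
    refine Finset.mem_coe.2 (Finset.mem_Icc.2 ⟨i.pos, ?_⟩)
    rw [Nat.le_div_iff_mul_le q.pos, mul_comm]
    exact_mod_cast hi.2
  · intro i hi
    have hi := Finset.mem_Icc.1 (Finset.mem_coe.1 hi)
    refine ⟨⟨i, hi.1⟩, ?_, rfl⟩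
    have h1 := hi.2
    rw [Nat.le_div_iff_mul_le q.pos] at h1
    simp only [Finset.coe_filter, Finset.mem_Icc, ← PNat.coe_le_coe, PNat.mul_coe, PNat.one_coe]
    refine ⟨⟨hi.1, hi.2.trans (Nat.div_le_self _ _)⟩, by rwa [mul_comm]⟩

theorem dilateCount_eq (p N : Fin d → ℕ+) (k : ℕ) :
    dilateCount p N k = ∏ c, (N c : ℕ) / (p c : ℕ) ^ k := by
  classical
  have : ((Finset.Icc 1 N).filter fun i => p ^ k * i ≤ N) =
      Fintype.piFinset fun c => (Finset.Icc 1 (N c)).filter fun i => p c ^ k * i ≤ N c := by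
    ext i
    simp only [Finset.mem_filter, Finset.mem_Icc, Fintype.mem_piFinset, Pi.le_def, Pi.mul_apply,
      Pi.pow_apply, Pi.one_apply, forall_and]
  rw [dilateCount, this, Fintype.card_piFinset]
  refine Finset.prod_congr rfl fun c _ => ?_
  rw [card_filter_mul_le, PNat.pow_coe]

theorem dilateCount_eq_zero {c : Fin d} (hc : 2 ≤ (p c : ℕ)) {N : Fin d → ℕ+} {k : ℕ}
    (hk : (N c : ℕ) ≤ k) : dilateCount p N k = 0 := by
  classical
  rw [dilateCount, Finset.card_eq_zero, Finset.filter_eq_empty_iff]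
  exact fun j _ => not_pow_mul_le hc hk j

theorem vol_pos (N : Fin d → ℕ+) : 0 < vol N :=
  Finset.prod_pos fun c _ => by exact_mod_cast (N c).pos

theorem dilateCount_div_vol (p N : Fin d → ℕ+) (k : ℕ) : (dilateCount p N k : ℝ) / vol N =
    ∏ c, (((N c : ℕ) / (p c : ℕ) ^ k : ℕ) : ℝ) / ((N c : ℕ) : ℝ) := by
  rw [dilateCount_eq, vol, Finset.prod_div_distrib]
  push_cast
  rfl

theorem dilateCount_div_vol_le (p N : Fin d → ℕ+) (k : ℕ) :
    (dilateCount p N k : ℝ) / vol N ≤ (vol p ^ k)⁻¹ := by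
  rw [dilateCount_div_vol, vol, ← Finset.prod_pow, ← Finset.prod_inv_distrib]
  refine Finset.prod_le_prod (fun c _ => by positivity) fun c _ => ?_
  have hN : (0 : ℝ) < ((N c : ℕ) : ℝ) := by exact_mod_cast (N c).pos
  rw [div_le_iff₀ hN, inv_mul_eq_div]
  exact_mod_cast Nat.cast_div_le (α := ℝ)

theorem tendsto_coord_atTop (c : Fin d) :
    Tendsto (fun N : Fin d → ℕ+ => ((N c : ℕ) : ℝ)) atTop atTop := by
  refine tendsto_natCast_atTop_atTop.comp (tendsto_atTop.2 fun b => ?_)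
  filter_upwards [eventually_ge_atTop (fun _ => b.succPNat : Fin d → ℕ+)] with N hN
  have := (PNat.coe_le_coe _ _).2 (hN c)
  rw [Nat.succPNat_coe] at this
  omega

theorem tendsto_vol_atTop (hd : 1 ≤ d) : Tendsto (vol (d := d)) atTop atTop := by
  refine tendsto_atTop_mono (fun N => ?_) (tendsto_coord_atTop (⟨0, hd⟩ : Fin d))
  rw [vol, ← Finset.mul_prod_erase _ _ (Finset.mem_univ (⟨0, hd⟩ : Fin d))]
  refine le_mul_of_one_le_right (by positivity) ?_
  have : ∀ c ∈ Finset.univ.erase (⟨0, hd⟩ : Fin d), (1 : ℝ) ≤ ((N c : ℕ) : ℝ) :=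
    fun c _ => by exact_mod_cast (N c).pos
  exact Finset.one_le_prod this

theorem tendsto_dilateCount_div_vol (p : Fin d → ℕ+) (k : ℕ) :
    Tendsto (fun N => (dilateCount p N k : ℝ) / vol N) atTop (𝓝 (vol p ^ k)⁻¹) := by
  simp_rw [dilateCount_div_vol]
  rw [vol, ← Finset.prod_pow, ← Finset.prod_inv_distrib]
  refine tendsto_finsetProd _ fun c _ => ?_
  have hq : (0 : ℝ) ≤ (((p c : ℕ) : ℝ) ^ k)⁻¹ := by positivity
  refine ((tendsto_nat_floor_mul_div_atTop hq).comp (tendsto_coord_atTop c)).congr fun N => ?_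
  simp only [Function.comp_apply]
  rw [inv_mul_eq_div, ← Nat.cast_pow, Nat.floor_div_natCast, Nat.floor_natCast]

end Chains

end MultIsing

end

noncomputable section

namespace MultIsing

/-! ### The infinite-volume free energy and its closed form -/

section FreeEnergy

variable {d : ℕ} {p : Fin d → ℕ+} {r : unitInterval}

instance (d : ℕ) (r : unitInterval) : IsProbabilityMeasure (spinMeasure d r) := by
  unfold spinMeasure
  infer_instance

theorem integral_exp_multipleSum (hp : p ≠ 1) (r : unitInterval) (β : ℝ) {N : Fin d → ℕ+}
    {L : (Fin d → ℕ+) → ℕ} (hL : ∀ j k, k < L j ↔ p ^ k * j ≤ N) :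
    ∫ σ, Real.exp (β * multipleSum p N σ) ∂(spinMeasure d r) =
      ∏ j ∈ boxRoots p N, chainPartition r β (L j) := by
  have h : ∀ σ : Config d, Real.exp (β * multipleSum p N σ) =
      ∏ j ∈ boxRoots p N, chainWeight β (L j) (fun k => σ (p ^ k * (j : Fin d → ℕ+))) := by
    intro σ
    rw [multipleSum, sum_Icc_eq_sum_boxRoots hp hL, Finset.mul_sum, Real.exp_sum]
    refine Finset.prod_congr rfl fun j _ => ?_
    simp only [chainWeight, pow_succ', mul_assoc]
  simp_rw [h, ← integral_chainWeight r]
  exact integral_prod_blocks (bernoulliMeasure (1 : ℤˣ) (-1) r) injective_pow_mul_chainRoot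
    (boxRoots p N) (g := fun j => chainWeight β (L j)) fun j => measurable_chainWeight β _

theorem dilateCount_succ_le (p N : Fin d → ℕ+) (k : ℕ) :
    dilateCount p N (k + 1) ≤ dilateCount p N k := by
  classical
  have := card_boxRoots_filter p N k
  omega

/-- Exchange the sums over chains and bonds: the `k`-th increment is weighted by the number of
chains with more than `k` bonds. Only finitely many terms are nonzero; the infinite sum prepares
dominated convergence. -/
theorem finiteFreeEnergy_eq_tsum (hp : p ≠ 1) (hr0 : 0 < (r : ℝ)) (hr1 : (r : ℝ) < 1) (β : ℝ)
    (N : Fin d → ℕ+) : finiteFreeEnergy p r β N =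
      ∑' k, ((dilateCount p N k : ℝ) / vol N - (dilateCount p N (k + 1) : ℝ) / vol N) *
        chainIncrement r β k := by
  classical
  obtain ⟨L, hL⟩ := exists_chainLength hp N
  obtain ⟨c, hc⟩ := exists_two_le hp
  have hzero : ∀ k ∉ Finset.range (N c : ℕ), ((dilateCount p N k : ℝ) / vol N -
      (dilateCount p N (k + 1) : ℝ) / vol N) * chainIncrement r β k = 0 := by
    intro k hk
    rw [Finset.mem_range, not_lt] at hk
    rw [dilateCount_eq_zero hc hk, dilateCount_eq_zero hc (hk.trans (Nat.le_succ k))]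
    simp
  have hlog : ∀ j : chainRoots p, Real.log (chainPartition r β (L j)) =
      ∑ k ∈ Finset.range (N c : ℕ),
        if p ^ k * (j : Fin d → ℕ+) ≤ N then chainIncrement r β k else 0 := by
    intro j
    rw [log_chainPartition_eq_sum, ← Finset.sum_filter]
    congr 1
    ext k
    simp only [Finset.mem_filter, Finset.mem_range, hL]
    refine ⟨fun h => ⟨?_, h⟩, And.right⟩
    by_contra! hk
    exact not_pow_mul_le hc hk _ h
  rw [tsum_eq_sum hzero, finiteFreeEnergy, integral_exp_multipleSum hp r β hL,
    Real.log_prod fun j _ => (chainPartition_pos hr0 hr1 β _).ne']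
  simp_rw [hlog]
  rw [Finset.sum_comm, Finset.sum_div]
  refine Finset.sum_congr rfl fun k _ => ?_
  rw [← Finset.sum_filter, Finset.sum_const, nsmul_eq_mul, ← card_boxRoots_filter p N k]
  push_cast
  ring

/-- The infinite-volume free energy, as a sum over the bonds of a chain. -/
def chainFreeEnergy (P r β : ℝ) : ℝ :=
  ∑' k, ((P ^ k)⁻¹ - (P ^ (k + 1))⁻¹) * chainIncrement r β k

theorem one_lt_vol (hp : p ≠ 1) : 1 < vol p := by
  obtain ⟨c, hc⟩ := exists_two_le hp
  rw [vol, ← Finset.mul_prod_erase _ _ (Finset.mem_univ c)]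
  have h1 : (1 : ℝ) ≤ ∏ j ∈ Finset.univ.erase c, ((p j : ℕ) : ℝ) :=
    Finset.one_le_prod fun j _ => by exact_mod_cast (p j).pos
  have h2 : (2 : ℝ) ≤ ((p c : ℕ) : ℝ) := by exact_mod_cast hc
  nlinarith

theorem summable_inv_pow {P : ℝ} (hP : 1 < P) : Summable fun k : ℕ => (P ^ k)⁻¹ := by
  simpa only [inv_pow] using
    summable_geometric_of_lt_one (inv_nonneg.2 (zero_le_one.trans hP.le)) (inv_lt_one_of_one_lt₀ hP)

theorem summable_inv_pow_mul_natCast {P : ℝ} (hP : 1 < P) :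
    Summable fun k : ℕ => (P ^ k)⁻¹ * (k : ℝ) := by
  have h : ‖P⁻¹‖ < 1 := by
    rw [Real.norm_eq_abs, abs_inv, abs_of_pos (by linarith)]
    exact inv_lt_one_of_one_lt₀ hP
  simpa [mul_comm] using summable_pow_mul_geometric_of_norm_lt_one 1 h

theorem inv_pow_succ_le {P : ℝ} (hP : 1 < P) (k : ℕ) : (P ^ (k + 1))⁻¹ ≤ (P ^ k)⁻¹ :=
  inv_anti₀ (by positivity) (pow_le_pow_right₀ hP.le (Nat.le_succ k))

theorem tendsto_finiteFreeEnergy (hp : p ≠ 1) (hr0 : 0 < (r : ℝ)) (hr1 : (r : ℝ) < 1) (β : ℝ) :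
    Tendsto (finiteFreeEnergy p r β) atTop (𝓝 (chainFreeEnergy (vol p) r β)) := by
  have heq : finiteFreeEnergy p r β = _ := funext (finiteFreeEnergy_eq_tsum hp hr0 hr1 β)
  rw [heq]
  refine tendsto_tsum_of_dominated_convergence
    ((summable_inv_pow (one_lt_vol hp)).mul_right |β|) (fun k => ?_) (.of_forall fun N k => ?_)
  · exact ((tendsto_dilateCount_div_vol p k).sub (tendsto_dilateCount_div_vol p (k + 1))).mul_const _
  · have hv := vol_pos N
    have h1 : (0 : ℝ) ≤ (dilateCount p N (k + 1) : ℝ) / vol N := by positivity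
    have h2 : (dilateCount p N (k + 1) : ℝ) / vol N ≤ (dilateCount p N k : ℝ) / vol N := by
      have := dilateCount_succ_le p N k
      gcongr
    rw [norm_mul, Real.norm_eq_abs, Real.norm_eq_abs, abs_of_nonneg (sub_nonneg.2 h2)]
    have h3 := dilateCount_div_vol_le p N k
    exact mul_le_mul (by linarith) (abs_chainIncrement_le hr0 hr1 β k) (abs_nonneg _)
      (inv_nonneg.2 (pow_nonneg (vol_pos p).le k))

theorem differentiable_chainFreeEnergy {P r : ℝ} (hP : 1 < P) (hr0 : 0 < r) (hr1 : r < 1) :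
    Differentiable ℝ (chainFreeEnergy P r) := by
  have hsum : Summable fun k : ℕ => (P ^ k)⁻¹ * (2 * k + 1) :=
    (((summable_inv_pow_mul_natCast hP).mul_left 2).add (summable_inv_pow hP)).congr
      fun k => by ring
  refine differentiable_tsum' hsum (fun k β =>
    (((differentiable_chainIncrement hr0 hr1 k) β).hasDerivAt.const_mul _)) fun k β => ?_
  have h1 := inv_pow_succ_le hP k
  have h0 : 0 < (P ^ (k + 1))⁻¹ := by positivity
  rw [norm_mul, Real.norm_eq_abs, Real.norm_eq_abs, abs_of_nonneg (sub_nonneg.2 h1)]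
  exact mul_le_mul (by linarith) (abs_deriv_chainIncrement_le hr0 hr1 k β) (abs_nonneg _)
    (by positivity)

theorem abs_log_chainPartition_le {r : ℝ} (hr0 : 0 < r) (hr1 : r < 1) (β : ℝ) (k : ℕ) :
    |Real.log (chainPartition r β k)| ≤ k * |β| := by
  rw [log_chainPartition_eq_sum]
  refine (Finset.abs_sum_le_sum_abs _ _).trans
    ((Finset.sum_le_sum fun i _ => abs_chainIncrement_le hr0 hr1 β i).trans_eq ?_)
  simp

/-- The logarithm in the `k`-th term of the series `𝒢(β)`. -/
def logCorrection (r β : ℝ) (k : ℕ) : ℝ :=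
  Real.log (1 + (2 * Real.cosh (field r) / overlapSq r β - 1) * (lamMinus r β / lamPlus r β) ^ k)

/-- The linear bound on the log partition function suffices; decay of `(Λ_- / Λ_+) ^ k` is not used.
-/
theorem summable_logCorrection {P r : ℝ} (hP : 1 < P) (hr0 : 0 < r) (hr1 : r < 1) (β : ℝ) :
    Summable fun k : ℕ => (P ^ k)⁻¹ * logCorrection r β k := by
  have hZ : Summable fun k : ℕ => (P ^ k)⁻¹ * Real.log (chainPartition r β k) := by
    refine Summable.of_norm_bounded ((summable_inv_pow_mul_natCast hP).mul_right |β|) fun k => ?_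
    have h0 : 0 < (P ^ k)⁻¹ := by positivity
    rw [norm_mul, Real.norm_eq_abs, Real.norm_eq_abs, abs_of_pos h0, mul_assoc]
    exact mul_le_mul_of_nonneg_left (abs_log_chainPartition_le hr0 hr1 β k) h0.le
  refine ((hZ.sub ((summable_inv_pow_mul_natCast hP).mul_right
    (Real.log (r * (1 - r)) / 2 + Real.log (lamPlus r β)))).sub ((summable_inv_pow hP).mul_right
    (Real.log (r * (1 - r)) / 2 + Real.log (overlapSq r β)))).congr fun k => ?_
  rw [log_chainPartition_eq hr0 hr1, logCorrection]
  ring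

theorem gTerm_succ_eq {P : ℝ} (hP : 1 < P) (r β : ℝ) (l : ℕ) : gTerm P r β (l + 1) =
    (1 - P⁻¹) ^ 2 * P * ((P ^ (l + 1))⁻¹ * logCorrection r β (l + 1)) := by
  have : P ≠ 0 := by linarith
  rw [gTerm, logCorrection]
  field_simp
  ring

theorem summable_gTerm {P r : ℝ} (hP : 1 < P) (hr0 : 0 < r) (hr1 : r < 1) (β : ℝ) :
    Summable fun l : ℕ => gTerm P r β (l + 1) := by
  simp_rw [gTerm_succ_eq hP]
  exact ((summable_nat_add_iff 1).2 (summable_logCorrection hP hr0 hr1 β)).mul_left _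

/-- Summation by parts: the increment produces two copies of the correction series, shifted by one
index, which combine with coefficient `(1 - P⁻¹) * (P - 1)`. The unmatched term `k = 0` is known
because a chain without bonds has partition function `1`, and it supplies the overlap term. -/
theorem chainFreeEnergy_eq {P r : ℝ} (hP : 1 < P) (hr0 : 0 < r) (hr1 : r < 1) (β : ℝ) :
    chainFreeEnergy P r β = (2 * P - 1) / (2 * P) * Real.log (r * (1 - r))
      + (P - 1) / P * Real.log (overlapSq r β) + Real.log (lamPlus r β)
      + ∑' l : ℕ, gTerm P r β (l + 1) := by
  have hP0 : P ≠ 0 := by linarith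
  have hs := summable_logCorrection hP hr0 hr1 β
  have hs1 := (summable_nat_add_iff 1).2 hs
  have hgeo : ∑' k : ℕ, (P ^ k)⁻¹ = (1 - P⁻¹)⁻¹ := by
    simp_rw [← inv_pow]
    exact tsum_geometric_of_lt_one (by positivity) (inv_lt_one_of_one_lt₀ hP)
  have hterm : ∀ k : ℕ, ((P ^ k)⁻¹ - (P ^ (k + 1))⁻¹) * chainIncrement r β k =
      (1 - P⁻¹) * (Real.log (r * (1 - r)) / 2 + Real.log (lamPlus r β)) * (P ^ k)⁻¹
      + (1 - P⁻¹) * P * ((P ^ (k + 1))⁻¹ * logCorrection r β (k + 1))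
      - (1 - P⁻¹) * ((P ^ k)⁻¹ * logCorrection r β k) := by
    intro k
    rw [chainIncrement, log_chainPartition_eq hr0 hr1, log_chainPartition_eq hr0 hr1,
      logCorrection, logCorrection, pow_succ]
    push_cast
    field_simp
    ring
  have h0 : logCorrection r β 0 = -(Real.log (r * (1 - r)) / 2) - Real.log (overlapSq r β) := by
    have := log_chainPartition_eq hr0 hr1 β 0
    rw [chainPartition_zero, Real.log_one] at this
    rw [logCorrection]
    push_cast at this
    linarith
  have hsplit := hs.tsum_eq_zero_add
  simp_rw [gTerm_succ_eq hP]
  rw [chainFreeEnergy, tsum_congr hterm,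
    (((summable_inv_pow hP).mul_left _).add (hs1.mul_left _)).tsum_sub (hs.mul_left _),
    ((summable_inv_pow hP).mul_left _).tsum_add (hs1.mul_left _), tsum_mul_left, tsum_mul_left,
    tsum_mul_left, tsum_mul_left, hsplit, hgeo, h0]
  have hP1 : 1 - P⁻¹ ≠ 0 := (sub_pos.2 (inv_lt_one_of_one_lt₀ hP)).ne'
  have hP1' : P - 1 ≠ 0 := by linarith
  generalize ∑' k : ℕ, (P ^ (k + 1))⁻¹ * logCorrection r β (k + 1) = S
  field_simp
  ring

end FreeEnergy

/-! ### Boundedness, measurability and cumulants of the average -/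

section Average

variable {d : ℕ}

theorem card_Icc_eq_vol (N : Fin d → ℕ+) : ((Finset.Icc 1 N).card : ℝ) = vol N := by
  simp [vol, Pi.card_Icc]

theorem abs_multipleSum_le (p N : Fin d → ℕ+) (σ : Config d) : |multipleSum p N σ| ≤ vol N := by
  rw [← card_Icc_eq_vol]
  refine (Finset.abs_sum_le_sum_abs _ _).trans_eq ?_
  simp [abs_mul, abs_spin]

theorem multipleSum_one (N : Fin d → ℕ+) (σ : Config d) : multipleSum 1 N σ = vol N := by
  rw [← card_Icc_eq_vol, multipleSum]
  have : ∀ s : ℤˣ, ((s : ℤ) : ℝ) * ((s : ℤ) : ℝ) = 1 := fun s => by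
    rcases Int.units_eq_one_or s with rfl | rfl <;> simp
  simp [this]

theorem finiteFreeEnergy_one (r : unitInterval) (β : ℝ) (N : Fin d → ℕ+) :
    finiteFreeEnergy 1 r β N = β := by
  simp [finiteFreeEnergy, multipleSum_one, (vol_pos N).ne']

theorem measurable_multipleAverage (p N : Fin d → ℕ+) : Measurable (multipleAverage p N) := by
  have h : ∀ i : Fin d → ℕ+, Measurable fun σ : Config d => ((σ i : ℤ) : ℝ) := fun i =>
    (Measurable.of_discrete (f := fun s : ℤˣ => ((s : ℤ) : ℝ))).comp (measurable_pi_apply i)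
  exact (Finset.measurable_fun_sum _ fun i _ => (h i).mul (h (p * i))).div_const _

theorem abs_multipleAverage_le (p N : Fin d → ℕ+) (σ : Config d) :
    |multipleAverage p N σ| ≤ 1 := by
  rw [multipleAverage, abs_div, abs_of_pos (vol_pos N), div_le_one (vol_pos N)]
  exact abs_multipleSum_le p N σ

theorem cgf_map_multipleAverage_div (p : Fin d → ℕ+) (r : unitInterval) (β : ℝ)
    (N : Fin d → ℕ+) :
    cgf (fun x => β * x) ((spinMeasure d r).map (multipleAverage p N)) (vol N) / vol N =
      finiteFreeEnergy p r β N := by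
  rw [cgf, mgf, integral_map (measurable_multipleAverage p N).aemeasurable
    (Measurable.aestronglyMeasurable (by fun_prop)), finiteFreeEnergy]
  congr 3
  ext σ
  have := (vol_pos N).ne'
  rw [multipleAverage]
  congr 1
  field_simp

end Average

end MultIsing

end

/-! ### Assembly -/

theorem theorem3p1 (d : ℕ) (hd : 1 ≤ d) (p : Fin d → ℕ+)
    (hp : ∀ i j : Fin d, i < j → Nat.gcd (p i : ℕ) (p j : ℕ) = 1)
    (r : unitInterval) (hr0 : 0 < (r : ℝ)) (hr1 : (r : ℝ) < 1) :
    ∃ F : ℝ → ℝ,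
      (∀ β : ℝ, Tendsto (MultIsing.finiteFreeEnergy p r β) atTop (𝓝 (F β))) ∧
      ((∃ j, p j ≠ 1) → ∀ β : ℝ,
        Summable (fun l : ℕ => MultIsing.gTerm (MultIsing.vol p) r β (l + 1)) ∧
        F β = (2 * MultIsing.vol p - 1) / (2 * MultIsing.vol p) * Real.log ((r : ℝ) * (1 - r))
          + (MultIsing.vol p - 1) / MultIsing.vol p * Real.log (MultIsing.overlapSq r β)
          + Real.log (MultIsing.lamPlus r β)
          + ∑' l : ℕ, MultIsing.gTerm (MultIsing.vol p) r β (l + 1)) ∧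
      Differentiable ℝ F ∧
      MultIsing.SatisfiesLDP (atTop : Filter (Fin d → ℕ+)) MultIsing.vol
        (fun N => (MultIsing.spinMeasure d r).map (MultIsing.multipleAverage p N))
        (MultIsing.legendre F) ∧
      MultIsing.IsLocalRate (atTop : Filter (Fin d → ℕ+)) MultIsing.vol
        (fun N => (MultIsing.spinMeasure d r).map (MultIsing.multipleAverage p N))
        (MultIsing.legendre F) ∧
      ∀ η y : ℝ, HasDerivAt F y η → MultIsing.legendre F y = ((η * y - F η : ℝ) : EReal) := by
  obtain ⟨F, hlim, hform, hdiff⟩ : ∃ F : ℝ → ℝ,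
      (∀ β : ℝ, Tendsto (MultIsing.finiteFreeEnergy p r β) atTop (𝓝 (F β))) ∧
      ((∃ j, p j ≠ 1) → F = MultIsing.chainFreeEnergy (MultIsing.vol p) r) ∧ Differentiable ℝ F := by
    -- With `p = 1` each site is its own partner, so there are no chains to decompose; the limit is
    -- the identity.
    by_cases h1 : p = 1
    · subst h1
      refine ⟨id, fun β => ?_, fun ⟨j, hj⟩ => absurd rfl hj, differentiable_id⟩
      simp only [funext (MultIsing.finiteFreeEnergy_one r β)]
      exact tendsto_const_nhds
    · exact ⟨MultIsing.chainFreeEnergy (MultIsing.vol p) r, MultIsing.tendsto_finiteFreeEnergy h1 hr0 hr1, fun _ => rfl,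
        MultIsing.differentiable_chainFreeEnergy (MultIsing.one_lt_vol h1) hr0 hr1⟩
  have hvol := MultIsing.tendsto_vol_atTop hd
  have hprob : ∀ N, IsProbabilityMeasure ((MultIsing.spinMeasure d r).map
      (MultIsing.multipleAverage p N)) := fun N =>
    Measure.isProbabilityMeasure_map (MultIsing.measurable_multipleAverage p N).aemeasurable
  have hbdd : ∀ N, ∀ᵐ x ∂(MultIsing.spinMeasure d r).map (MultIsing.multipleAverage p N),
      |x| ≤ 1 := fun N =>
    (ae_map_iff (MultIsing.measurable_multipleAverage p N).aemeasurable
      (measurableSet_le (by fun_prop) measurable_const)).2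
      (.of_forall (MultIsing.abs_multipleAverage_le p N))
  have hcgf : ∀ β, Tendsto (fun N => cgf (fun x => β * x)
      ((MultIsing.spinMeasure d r).map (MultIsing.multipleAverage p N)) (MultIsing.vol N) /
      MultIsing.vol N) atTop (𝓝 (F β)) := fun β =>
    (hlim β).congr fun N => (MultIsing.cgf_map_multipleAverage_div p r β N).symm
  have hldp := MultIsing.satisfiesLDP_legendre hvol hbdd hcgf hdiff
  refine ⟨F, hlim, fun hj β => ?_, hdiff, hldp,
    hldp.isLocalRate_legendre (MultIsing.limit_cgf_zero hcgf) hvol,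
    fun η y hd => MultIsing.legendre_eq_of_hasDerivAt hvol hbdd hcgf hd⟩
  have hP := MultIsing.one_lt_vol (Function.ne_iff.2 hj)
  rw [hform hj]
  exact ⟨MultIsing.summable_gTerm hP hr0 hr1 β, MultIsing.chainFreeEnergy_eq hP hr0 hr1 β⟩
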